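/- Let $\frac12<\alpha<1$, $s<\frac{1-\alpha}{2}$, $r>0$ and $T>0$. Let $\mathbb{T}=\mathbb{R}/2\pi\mathbb{Z}$, and let $H^s(\mathbb{T})$ be the completion of $C^\infty(\mathbb{T})$ under the norm $\|f\|_{H^s}^2=\frac1{2\pi}\sum_{k\in\mathbb{Z}}(1+k^2)^{s}|\hat f(k)|^2$, where $\hat f(k)=\int_0^{2\pi}e^{-ikx}f(x)\,dx$. Consider the fractional nonlinear Schrödinger equation $$ i\partial_t u+(-\Delta)^\alpha u=-|u|^2u,\qquad u(\cdot,0)=u_0, $$ on $\mathbb{T}$, where $(-\Delta)^\alpha$ is the Fourier multiplier with symbol $|k|^{2\alpha}$. Suppose that the data-to-solution map of this equation for smooth initial data extends continuously to the closed ball $B_r=\{u_0\in H^s(\mathbb{T}):\|u_0\|_{H^s}\le r\}$; that is, suppose that there is a continuous map $\Phi:B_r\to C^0([0,T];H^s(\mathbb{T}))$ such that, for every smooth $u_0\in B_r$, $\Phi(u_0)$ is the smooth solution of the equation on $[0,T]\times\mathbb{T}$ with initial datum $u_0$. Then $\Phi$ is not $C^3$ (as a map between real normed spaces, in the sense of Fréchet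 derivatives) at the origin. -/

import Mathlib

open Set
open scoped ContDiff

noncomputable section

namespace FNLS

/-- The `k`-th Fourier coefficient `∫_0^{2π} e^{-ikx} f(x) dx` of a `2π`-periodic function. -/
def fourierCoef (f : ℝ → ℂ) (k : ℤ) : ℂ :=
  ∫ x in (0 : ℝ)..(2 * Real.pi), Complex.exp (-(Complex.I * k * x)) * f x

/-- The Japanese bracket `⟨k⟩ = (1 + |k|²)^{1/2}`. -/
def bracket (k : ℤ) : ℝ := Real.sqrt (1 + (k : ℝ) ^ 2)

theorem bracket_pos (k : ℤ) : 0 < bracket k :=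
  Real.sqrt_pos.2 (by positivity)

/-- The weight `⟨k⟩^s / √(2π)`; the factor `1 / √(2π)` is the square root of the mass of a point
for the normalized counting measure `(2π)⁻¹ ∑_k`. -/
def weight (s : ℝ) (k : ℤ) : ℝ := bracket k ^ s / Real.sqrt (2 * Real.pi)

theorem weight_pos (s : ℝ) (k : ℤ) : 0 < weight s k :=
  div_pos (Real.rpow_pos_of_pos (bracket_pos k) s) (Real.sqrt_pos.2 (by positivity))

/-- The sequences `a : ℤ → ℂ` of Fourier coefficients with `∑_k ⟨k⟩^{2s} |a k|² < ∞`. -/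
def sobolevSubmodule (s : ℝ) : Submodule ℂ (ℤ → ℂ) where
  carrier := {a | Memℓp (fun k => (weight s k : ℂ) * a k) 2}
  zero_mem' := by
    have h := zero_memℓp (E := fun _ : ℤ => ℂ) (p := 2)
    simp only [mem_ofPred_eq, Pi.zero_apply, mul_zero]
    exact h
  add_mem' := by
    intro a b ha hb
    have h := Memℓp.add ha hb
    simp only [mem_ofPred_eq, Pi.add_apply, mul_add]
    exact h
  smul_mem' := by
    intro c a ha
    have h := Memℓp.const_smul ha c
    simp only [mem_ofPred_eq, Pi.smul_apply, smul_eq_mul, mul_left_comm _ c]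
    exact h

/-- The Sobolev space `H^s(𝕋)`, `𝕋 = ℝ / 2πℤ`, for arbitrary real `s`. An element is given by its
sequence of Fourier coefficients. -/
def Hs (s : ℝ) : Type := sobolevSubmodule s

namespace Hs

variable {s : ℝ}

instance : AddCommGroup (Hs s) := inferInstanceAs (AddCommGroup (sobolevSubmodule s))

instance : Module ℂ (Hs s) := inferInstanceAs (Module ℂ (sobolevSubmodule s))

/-- The Fourier coefficients of an element of `H^s(𝕋)`. -/
def coeff (a : Hs s) (k : ℤ) : ℂ := a.1 k

/-- The map `a ↦ (⟨k⟩^s a(k) / √(2π))_k` from `H^s(𝕋)` to `ℓ²(ℤ)`. -/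
def toEll2 (s : ℝ) : Hs s →ₗ[ℂ] lp (fun _ : ℤ => ℂ) 2 where
  toFun a := ⟨fun k => (weight s k : ℂ) * a.1 k, a.2⟩
  map_add' a b := by
    ext k
    exact mul_add _ _ _
  map_smul' c a := by
    ext k
    exact mul_left_comm _ _ _

theorem toEll2_injective (s : ℝ) : Function.Injective (toEll2 s) := by
  intro a b h
  apply Subtype.ext
  funext k
  have hk : (weight s k : ℂ) * a.1 k = (weight s k : ℂ) * b.1 k :=
    congrArg (fun f : lp (fun _ : ℤ => ℂ) 2 => f k) h
  exact mul_left_cancel₀ (Complex.ofReal_ne_zero.2 (weight_pos s k).ne') hk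

/-- The norm `‖f‖_{H^s} = ((2π)⁻¹ ∑_k ⟨k⟩^{2s} |f̂(k)|²)^{1/2}`, see `Hs.norm_sq_eq`. -/
instance : NormedAddCommGroup (Hs s) :=
  NormedAddCommGroup.induced (Hs s) (lp (fun _ : ℤ => ℂ) 2) (toEll2 s) (toEll2_injective s)

instance : NormedSpace ℂ (Hs s) :=
  NormedSpace.induced ℂ (Hs s) (lp (fun _ : ℤ => ℂ) 2) (toEll2 s)

theorem norm_sq_eq (a : Hs s) :
    ‖a‖ ^ 2 = (2 * Real.pi)⁻¹ * ∑' k : ℤ, bracket k ^ (2 * s) * ‖a.coeff k‖ ^ 2 := by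
  have h := lp.norm_rpow_eq_tsum (p := 2) (by norm_num) (toEll2 s a)
  simp only [ENNReal.toReal_ofNat, Real.rpow_ofNat] at h
  have hn : ‖a‖ = ‖toEll2 s a‖ := rfl
  rw [hn, h, ← tsum_mul_left]
  congr 1
  funext k
  have hk : toEll2 s a k = (weight s k : ℂ) * a.coeff k := rfl
  rw [hk, norm_mul, Complex.norm_real, Real.norm_of_nonneg (weight_pos s k).le, mul_pow, weight,
    div_pow, Real.sq_sqrt (by positivity), two_mul s, Real.rpow_add (bracket_pos k)]
  ring

end Hs

/-- The fractional Laplacian `(-Δ)^α` on smooth `2π`-periodic functions, i.e. the Fourier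
multiplier with symbol `|k|^{2α}`. -/
def fracLaplacian (α : ℝ) (f : ℝ → ℂ) (x : ℝ) : ℂ :=
  (2 * Real.pi : ℂ)⁻¹ *
    ∑' k : ℤ, ((|(k : ℝ)| ^ (2 * α) : ℝ) : ℂ) * fourierCoef f k * Complex.exp (Complex.I * k * x)

/-- `f` is a smooth function on `𝕋 = ℝ / 2πℤ`. -/
def IsSmoothPeriodic (f : ℝ → ℂ) : Prop :=
  ContDiff ℝ ∞ f ∧ Function.Periodic f (2 * Real.pi)

/-- `u`, a function of `(t, x) ∈ [0,T] × 𝕋`, is a smooth solution of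
`i ∂_t u + (-Δ)^α u = -|u|² u` with `u(0, x) = φ(x)`. The values of `u t` for `t ∉ [0,T]` are
irrelevant; time derivatives at the endpoints are one-sided. -/
structure IsSmoothSolution (α T : ℝ) (φ : ℝ → ℂ) (u : ℝ → ℝ → ℂ) : Prop where
  smooth : ContDiffOn ℝ ∞ (fun p : ℝ × ℝ => u p.1 p.2) (Icc 0 T ×ˢ univ)
  periodic : ∀ t ∈ Icc (0 : ℝ) T, Function.Periodic (u t) (2 * Real.pi)
  equation : ∀ t ∈ Icc (0 : ℝ) T, ∀ x : ℝ,
    Complex.I * derivWithin (fun τ => u τ x) (Icc 0 T) t + fracLaplacian α (u t) x =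
      -((‖u t x‖ : ℂ) ^ 2 * u t x)
  initial : ∀ x : ℝ, u 0 x = φ x

/-- On the closed ball of radius `r` about the origin of `H^s(𝕋)`, `Φ` extends the data-to-solution
map for smooth data: it sends every smooth `φ` in the ball to a smooth solution on `[0,T]` with
initial datum `φ`. -/
def ExtendsSmoothFlow (α s r T : ℝ) (Φ : Hs s → C(Icc (0 : ℝ) T, Hs s)) : Prop :=
  ∀ φ : ℝ → ℂ, IsSmoothPeriodic φ →
    ∀ u₀ ∈ Metric.closedBall (0 : Hs s) r, (∀ k : ℤ, u₀.coeff k = fourierCoef φ k) →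
      ∃ u : ℝ → ℝ → ℂ, IsSmoothSolution α T φ u ∧
        ∀ (t : Icc (0 : ℝ) T) (k : ℤ), (Φ u₀ t).coeff k = fourierCoef (u t) k

end FNLS

end

open Set
open scoped ContDiff

noncomputable section

namespace FNLS

/-! A map that is C³ at the origin has third forward differences of size O(‖h‖³) near it, with one
constant for all directions h. This is tested on data εa, where a is a finite sum of unit modes over
a set S of frequencies. For fixed S and small ε, the k-th coefficient of the solution at time T is
e^{iT|k|^{2α}} (ε a_k + ε³ A_k) + O(ε⁵), where A_k is `cubicTerm`
(`IsSmoothSolution.exists_expansion`). The third difference of the values at ε, 2ε, 3ε, 4ε kills the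
linear term and leaves 6ε³ A_k. Dividing by ε³ and letting ε → 0 removes the remainder, although it
depends on S. So C³ regularity would force ‖A‖_{H^s} ≤ C‖a‖³_{H^s} with C independent of S
(`exists_cubicTerm_bound`).

This trilinear bound fails on a block of about m consecutive frequencies near N. An interaction a -
b + c = k oscillates in time with frequency |a|^{2α} - |b|^{2α} + |c|^{2α} - |k|^{2α}. Since a - b =
k - c, this is a second difference of z^{2α}, of size O(N^{2α-2} m²). For m a small multiple of
N^{1-α} it stays bounded, nothing cancels on [0,T], and |A_k| ≳ m² for m values of k
(`le_norm_cubicTerm`). The bound then reads m⁵ N^{2s} ≲ m³ N^{6s}, that is m² ≲ N^{4s}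
(`exists_resonance_bound`), which is false as N → ∞ when s < (1-α)/2 (`not_resonance_bound`).

The expansion is proved in the Wiener algebra of absolutely summable Fourier series, independently
of s. Existence of the smooth solution is part of the hypothesis on Φ, so only a priori bounds are
needed: Duhamel's formula and a continuity argument. -/

/-! ### Fourier coefficients of periodic functions -/

section FourierCoefficients

theorem continuous_char (k : ℤ) : Continuous fun x : ℝ => Complex.exp (Complex.I * k * x) := by
  fun_prop

theorem norm_char (k : ℤ) (x : ℝ) : ‖Complex.exp (Complex.I * k * x)‖ = 1 := by
  have h : Complex.I * k * x = ((k * x : ℝ) : ℂ) * Complex.I := by push_cast; ring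
  rw [h, Complex.norm_exp_ofReal_mul_I]

theorem norm_char_neg (k : ℤ) (x : ℝ) : ‖Complex.exp (-(Complex.I * k * x))‖ = 1 := by
  rw [Complex.exp_neg, norm_inv, norm_char, inv_one]

theorem periodic_char (k : ℤ) :
    Function.Periodic (fun x : ℝ => Complex.exp (Complex.I * k * x)) (2 * Real.pi) := by
  intro x
  have h : Complex.I * k * ((x + 2 * Real.pi : ℝ) : ℂ) =
      Complex.I * k * x + k * (2 * Real.pi * Complex.I) := by push_cast; ring
  simp only [h, Complex.exp_add, Complex.exp_int_mul_two_pi_mul_I, mul_one]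

theorem intervalIntegrable_char_mul {f : ℝ → ℂ} {a b : ℝ}
    (hf : IntervalIntegrable f MeasureTheory.volume a b) (k : ℤ) :
    IntervalIntegrable (fun x : ℝ => Complex.exp (-(Complex.I * k * x)) * f x)
      MeasureTheory.volume a b :=
  hf.continuousOn_mul (by fun_prop)

theorem norm_fourierCoef_le {f : ℝ → ℂ} {C : ℝ} (hf : ∀ x ∈ Icc 0 (2 * Real.pi), ‖f x‖ ≤ C)
    (k : ℤ) : ‖fourierCoef f k‖ ≤ 2 * Real.pi * C := by
  have h := intervalIntegral.norm_integral_le_of_norm_le_const (a := 0) (b := 2 * Real.pi)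
    (f := fun x : ℝ => Complex.exp (-(Complex.I * k * x)) * f x) (C := C) (by
      intro x hx
      rw [uIoc_of_le (by positivity)] at hx
      rw [norm_mul, norm_char_neg, one_mul]
      exact hf x ⟨hx.1.le, hx.2⟩)
  rw [sub_zero, abs_of_pos (by positivity)] at h
  rw [mul_comm]
  exact h

theorem fourierCoef_congr {f g : ℝ → ℂ} (h : ∀ x, f x = g x) (k : ℤ) :
    fourierCoef f k = fourierCoef g k := by
  rw [funext h]

theorem fourierCoef_sub {f g : ℝ → ℂ} (hf : Continuous f) (hg : Continuous g) (k : ℤ) :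
    fourierCoef (fun x => f x - g x) k = fourierCoef f k - fourierCoef g k := by
  simp only [fourierCoef, mul_sub]
  exact intervalIntegral.integral_sub (intervalIntegrable_char_mul (hf.intervalIntegrable _ _) k)
    (intervalIntegrable_char_mul (hg.intervalIntegrable _ _) k)

theorem fourierCoef_const_mul (c : ℂ) (f : ℝ → ℂ) (k : ℤ) :
    fourierCoef (fun x => c * f x) k = c * fourierCoef f k := by
  simp only [fourierCoef, ← intervalIntegral.integral_const_mul]
  congr 1
  funext x
  ring

theorem fourierCoef_char (l k : ℤ) :
    fourierCoef (fun x => Complex.exp (Complex.I * l * x)) k =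
      if l = k then (2 * Real.pi : ℂ) else 0 := by
  have h (x : ℝ) : Complex.exp (-(Complex.I * k * x)) * Complex.exp (Complex.I * l * x) =
      Complex.exp (Complex.I * ((l - k : ℤ) : ℂ) * x) := by
    rw [← Complex.exp_add]
    congr 1
    push_cast
    ring
  simp only [fourierCoef, h]
  split_ifs with hlk
  · simp [hlk]
  · have hne : Complex.I * ((l - k : ℤ) : ℂ) ≠ 0 :=
      mul_ne_zero Complex.I_ne_zero (Int.cast_ne_zero.2 (sub_ne_zero.2 hlk))
    rw [integral_exp_mul_complex hne]
    have h0 := periodic_char (l - k) 0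
    simp only [zero_add] at h0
    rw [h0]
    simp

theorem fourierCoef_hasSum {ι : Type*} [Countable ι] {f : ℝ → ℂ} {F : ι → ℝ → ℂ} {b : ι → ℝ}
    (hF : ∀ i, Continuous (F i)) (hb : ∀ i x, ‖F i x‖ ≤ b i) (hbs : Summable b)
    (hf : ∀ x, HasSum (fun i => F i x) (f x)) (k : ℤ) :
    HasSum (fun i => fourierCoef (F i) k) (fourierCoef f k) := by
  refine intervalIntegral.hasSum_integral_of_dominated_convergence (fun i _ => b i) ?_ ?_ ?_ ?_ ?_
  · intro i
    have := hF i
    exact Continuous.aestronglyMeasurable (by fun_prop)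
  · intro i
    refine Filter.Eventually.of_forall fun x _ => ?_
    rw [norm_mul, norm_char_neg, one_mul]
    exact hb i x
  · exact Filter.Eventually.of_forall fun _ _ => hbs
  · exact intervalIntegrable_const
  · exact Filter.Eventually.of_forall fun x _ => (hf x).mul_left _

theorem fourierCoef_tsum_char {c : ℤ → ℂ} (hc : Summable fun k => ‖c k‖) (k : ℤ) :
    fourierCoef (fun x => ∑' l, c l * Complex.exp (Complex.I * l * x)) k = 2 * Real.pi * c k := by
  have hn (l : ℤ) (x : ℝ) : ‖c l * Complex.exp (Complex.I * l * x)‖ ≤ ‖c l‖ := by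
    rw [norm_mul, norm_char, mul_one]
  have h := fourierCoef_hasSum (f := fun x => ∑' l, c l * Complex.exp (Complex.I * l * x))
    (F := fun l x => c l * Complex.exp (Complex.I * l * x))
    (fun l => continuous_const.mul (continuous_char l)) hn hc
    (fun x => (Summable.of_norm_bounded hc fun l => hn l x).hasSum) k
  rw [← h.tsum_eq, tsum_eq_single k]
  · rw [fourierCoef_const_mul, fourierCoef_char, if_pos rfl, mul_comm]
  · intro l hl
    rw [fourierCoef_const_mul, fourierCoef_char, if_neg hl, mul_zero]

theorem fourierCoef_conj (f : ℝ → ℂ) (k : ℤ) :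
    fourierCoef (fun x => starRingEnd ℂ (f x)) k = starRingEnd ℂ (fourierCoef f (-k)) := by
  have hp : (0 : ℝ) ≤ 2 * Real.pi := by positivity
  simp only [fourierCoef, intervalIntegral.integral_of_le hp]
  rw [← integral_conj]
  congr 1
  funext x
  rw [map_mul, ← Complex.exp_conj]
  simp

instance factTwoPiPos : Fact ((0 : ℝ) < 2 * Real.pi) := ⟨by positivity⟩

/-- Fourier inversion for functions with summable Fourier coefficients. -/
theorem hasSum_fourierCoef {f : ℝ → ℂ} (hf : Continuous f) (hp : Function.Periodic f (2 * Real.pi))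
    (hs : Summable fun k => ‖fourierCoef f k‖) (x : ℝ) :
    HasSum (fun k : ℤ => (2 * Real.pi : ℂ)⁻¹ * fourierCoef f k * Complex.exp (Complex.I * k * x))
      (f x) := by
  -- Descend to the circle, so that the pointwise convergence theorem for summable Fourier series
  -- applies; only the normalizations then have to be matched.
  let g : C(AddCircle (2 * Real.pi), ℂ) :=
    ⟨hp.lift, continuous_coinduced_dom.mpr hf⟩
  have hg (y : ℝ) : g (y : AddCircle (2 * Real.pi)) = f y := Function.Periodic.lift_coe hp y
  have hchar (n : ℤ) (y : ℝ) : @fourier (2 * Real.pi) n y = Complex.exp (Complex.I * n * y) := by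
    rw [fourier_coe_apply]
    congr 1
    have := Real.pi_ne_zero
    push_cast
    field_simp
  have hcoef (k : ℤ) : fourierCoeff g k = (2 * Real.pi : ℂ)⁻¹ * fourierCoef f k := by
    rw [fourierCoeff_eq_intervalIntegral g k 0, zero_add, fourierCoef, Complex.real_smul]
    congr 1
    · push_cast
      rw [one_div]
    · congr 1
      funext y
      rw [hg, hchar, smul_eq_mul]
      congr 2
      push_cast
      ring
  have hsum : Summable (fourierCoeff g) := by
    refine Summable.of_norm ?_
    simp only [hcoef, norm_mul]
    exact hs.mul_left _
  have h := has_pointwise_sum_fourier_series_of_summable hsum (x : AddCircle (2 * Real.pi))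
  simpa only [hcoef, hg, hchar, smul_eq_mul] using h

end FourierCoefficients

/-! ### The algebra of absolutely convergent Fourier series -/

section WienerAlgebra

/-- Continuous `2π`-periodic functions with absolutely summable Fourier coefficients. -/
structure IsWiener (f : ℝ → ℂ) : Prop where
  continuous : Continuous f
  periodic : Function.Periodic f (2 * Real.pi)
  summable : Summable fun k => ‖fourierCoef f k‖

/-- The `ℓ¹` norm of the Fourier coefficients. -/
def wienerNorm (f : ℝ → ℂ) : ℝ := ∑' k : ℤ, ‖fourierCoef f k‖

theorem wienerNorm_nonneg (f : ℝ → ℂ) : 0 ≤ wienerNorm f :=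
  tsum_nonneg fun _ => norm_nonneg _

theorem IsWiener.norm_le {f : ℝ → ℂ} (hf : IsWiener f) (x : ℝ) :
    ‖f x‖ ≤ (2 * Real.pi)⁻¹ * wienerNorm f := by
  have h := hasSum_fourierCoef hf.continuous hf.periodic hf.summable x
  rw [← h.tsum_eq]
  refine tsum_of_norm_bounded (hf.summable.hasSum.mul_left _) fun k => ?_
  rw [norm_mul, norm_char, mul_one, norm_mul, norm_inv]
  simp [abs_of_pos Real.pi_pos]

theorem IsWiener.conj {f : ℝ → ℂ} (hf : IsWiener f) :
    IsWiener (fun x => starRingEnd ℂ (f x)) ∧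
      wienerNorm (fun x => starRingEnd ℂ (f x)) = wienerNorm f := by
  have h (k : ℤ) : ‖fourierCoef (fun x => starRingEnd ℂ (f x)) k‖ = ‖fourierCoef f (-k)‖ := by
    rw [fourierCoef_conj, RCLike.norm_conj]
  refine ⟨⟨Complex.continuous_conj.comp hf.continuous, fun x => by simp only [hf.periodic x], ?_⟩,
    ?_⟩
  · simp only [h]
    exact (Equiv.neg ℤ).summable_iff.2 hf.summable
  · simp only [wienerNorm, h]
    exact (Equiv.neg ℤ).tsum_eq fun k => ‖fourierCoef f k‖

/-- Expand g in its Fourier series and integrate termwise; multiplying f by e^{ilx} shifts its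
coefficients by l. The sup bound on f gives the dominating sequence. -/
theorem hasSum_fourierCoef_mul {f g : ℝ → ℂ} (hf : IsWiener f) (hg : IsWiener g) (k : ℤ) :
    HasSum (fun l : ℤ => (2 * Real.pi : ℂ)⁻¹ * fourierCoef g l * fourierCoef f (k - l))
      (fourierCoef (fun x => f x * g x) k) := by
  have h := fourierCoef_hasSum (f := fun x => f x * g x)
    (F := fun (l : ℤ) x => (2 * Real.pi : ℂ)⁻¹ * fourierCoef g l *
      (Complex.exp (Complex.I * l * x) * f x))
    (b := fun l => ‖(2 * Real.pi : ℂ)⁻¹ * fourierCoef g l‖ * ((2 * Real.pi)⁻¹ * wienerNorm f))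
    (fun l => continuous_const.mul ((continuous_char l).mul hf.continuous))
    (fun l x => by
      rw [norm_mul, norm_mul (Complex.exp _), norm_char, one_mul]
      exact mul_le_mul_of_nonneg_left (hf.norm_le x) (norm_nonneg _))
    (by
      simp only [norm_mul]
      exact (hg.summable.mul_left _).mul_right _)
    (fun x => by
      have := (hasSum_fourierCoef hg.continuous hg.periodic hg.summable x).mul_left (f x)
      refine this.congr_fun ?_
      intro l
      ring) k
  refine h.congr_fun ?_
  intro l
  rw [fourierCoef_const_mul]
  congr 1
  simp only [fourierCoef]
  congr 1
  funext x
  rw [← mul_assoc, ← Complex.exp_add]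
  congr 2
  push_cast
  ring

/-- Young's inequality ℓ¹ * ℓ¹ ⊆ ℓ¹ for the convolution of the coefficients; each product costs a
factor (2π)⁻¹ in this normalization. -/
theorem IsWiener.mul {f g : ℝ → ℂ} (hf : IsWiener f) (hg : IsWiener g) :
    IsWiener (fun x => f x * g x) ∧
      wienerNorm (fun x => f x * g x) ≤ (2 * Real.pi)⁻¹ * (wienerNorm f * wienerNorm g) := by
  have hπ : ‖(2 * Real.pi : ℂ)⁻¹‖ = (2 * Real.pi)⁻¹ := by
    rw [norm_inv]; simp [abs_of_pos Real.pi_pos]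
  -- The shear (k, l) ↦ (l, k - l) turns the double sum of the convolution into a product of two
  -- sums.
  let e : ℤ × ℤ ≃ ℤ × ℤ :=
    { toFun := fun p => (p.2, p.1 - p.2)
      invFun := fun p => (p.2 + p.1, p.1)
      left_inv := fun p => by simp
      right_inv := fun p => by simp }
  have hS : Summable fun p : ℤ × ℤ => ‖fourierCoef g p.1‖ * ‖fourierCoef f p.2‖ :=
    hg.summable.mul_of_nonneg hf.summable (fun _ => norm_nonneg _) fun _ => norm_nonneg _
  have hS' : Summable fun p : ℤ × ℤ => ‖fourierCoef g p.2‖ * ‖fourierCoef f (p.1 - p.2)‖ :=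
    e.summable_iff.2 hS
  have htot : ∑' k : ℤ, ∑' l : ℤ, ‖fourierCoef g l‖ * ‖fourierCoef f (k - l)‖ =
      wienerNorm f * wienerNorm g := by
    rw [← hS'.tsum_prod, mul_comm, wienerNorm, wienerNorm,
      hg.summable.tsum_mul_tsum hf.summable hS]
    exact e.tsum_eq fun p : ℤ × ℤ => ‖fourierCoef g p.1‖ * ‖fourierCoef f p.2‖
  have hle (k : ℤ) : ‖fourierCoef (fun x => f x * g x) k‖ ≤
      (2 * Real.pi)⁻¹ * ∑' l : ℤ, ‖fourierCoef g l‖ * ‖fourierCoef f (k - l)‖ := by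
    rw [← (hasSum_fourierCoef_mul hf hg k).tsum_eq]
    refine tsum_of_norm_bounded ((hS'.prod_factor k).hasSum.mul_left _) fun l => ?_
    rw [norm_mul, norm_mul, hπ, mul_assoc]
  have hsum : Summable fun k : ℤ =>
      (2 * Real.pi)⁻¹ * ∑' l : ℤ, ‖fourierCoef g l‖ * ‖fourierCoef f (k - l)‖ :=
    hS'.prod.mul_left _
  have hs' := Summable.of_nonneg_of_le (fun _ => norm_nonneg _) hle hsum
  refine ⟨⟨hf.continuous.mul hg.continuous, fun x => by simp only [hf.periodic x, hg.periodic x],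
    hs'⟩, ?_⟩
  rw [← htot, ← tsum_mul_left]
  exact hs'.tsum_le_tsum hle hsum

theorem IsWiener.cubic {f : ℝ → ℂ} (hf : IsWiener f) :
    IsWiener (fun x => (‖f x‖ : ℂ) ^ 2 * f x) ∧
      wienerNorm (fun x => (‖f x‖ : ℂ) ^ 2 * f x) ≤ ((2 * Real.pi)⁻¹) ^ 2 * wienerNorm f ^ 3 := by
  have h1 := hf.mul hf.conj.1
  have h2 := h1.1.mul hf
  have heq : (fun x => (‖f x‖ : ℂ) ^ 2 * f x) = fun x => f x * starRingEnd ℂ (f x) * f x := by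
    funext x
    rw [Complex.mul_conj']
  rw [heq]
  refine ⟨h2.1, h2.2.trans ?_⟩
  have h3 := h1.2
  rw [hf.conj.2] at h3
  have := mul_le_mul_of_nonneg_right h3 (wienerNorm_nonneg f)
  calc _ ≤ (2 * Real.pi)⁻¹ * ((2 * Real.pi)⁻¹ * (wienerNorm f * wienerNorm f) * wienerNorm f) := by
        gcongr
    _ = _ := by ring

end WienerAlgebra

/-! ### Smooth functions on [0,T] × ℝ and their Fourier coefficients in x -/

section Slab

variable {T : ℝ}

theorem uniqueDiffOn_slab (hT : 0 < T) : UniqueDiffOn ℝ (Icc 0 T ×ˢ (univ : Set ℝ)) :=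
  (uniqueDiffOn_Icc hT).prod uniqueDiffOn_univ

/-- The spatial derivative of a function on `[0,T] × ℝ`. -/
def slabDerivX (T : ℝ) (g : ℝ × ℝ → ℂ) (p : ℝ × ℝ) : ℂ :=
  fderivWithin ℝ g (Icc 0 T ×ˢ univ) p (0, 1)

/-- The time derivative of a function on `[0,T] × ℝ`. -/
def slabDerivT (T : ℝ) (g : ℝ × ℝ → ℂ) (p : ℝ × ℝ) : ℂ :=
  fderivWithin ℝ g (Icc 0 T ×ˢ univ) p (1, 0)

theorem contDiffOn_slabDerivX (hT : 0 < T) {g : ℝ × ℝ → ℂ}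
    (hg : ContDiffOn ℝ ∞ g (Icc 0 T ×ˢ univ)) :
    ContDiffOn ℝ ∞ (slabDerivX T g) (Icc 0 T ×ˢ univ) :=
  (hg.fderivWithin (uniqueDiffOn_slab hT) (by simp)).clm_apply contDiffOn_const

theorem contDiffOn_slabDerivT (hT : 0 < T) {g : ℝ × ℝ → ℂ}
    (hg : ContDiffOn ℝ ∞ g (Icc 0 T ×ˢ univ)) :
    ContDiffOn ℝ ∞ (slabDerivT T g) (Icc 0 T ×ˢ univ) :=
  (hg.fderivWithin (uniqueDiffOn_slab hT) (by simp)).clm_apply contDiffOn_const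

theorem hasDerivAt_slabDerivX {g : ℝ × ℝ → ℂ}
    (hg : ContDiffOn ℝ ∞ g (Icc 0 T ×ˢ univ)) {t : ℝ} (ht : t ∈ Icc 0 T) (x : ℝ) :
    HasDerivAt (fun y => g (t, y)) (slabDerivX T g (t, x)) x := by
  have h1 := (hg.differentiableOn (by simp) (t, x) ⟨ht, mem_univ x⟩).hasFDerivWithinAt
  have h2 : HasDerivWithinAt (fun y : ℝ => (t, y)) ((0 : ℝ), (1 : ℝ)) univ x :=
    (hasDerivWithinAt_const x univ t).prodMk (hasDerivWithinAt_id x univ)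
  have h3 := h1.comp_hasDerivWithinAt x h2 fun y _ => mk_mem_prod ht (mem_univ y)
  exact h3.hasDerivAt Filter.univ_mem

theorem hasDerivWithinAt_slabDerivT {g : ℝ × ℝ → ℂ}
    (hg : ContDiffOn ℝ ∞ g (Icc 0 T ×ˢ univ)) {t : ℝ} (ht : t ∈ Icc 0 T) (x : ℝ) :
    HasDerivWithinAt (fun τ => g (τ, x)) (slabDerivT T g (t, x)) (Icc 0 T) t := by
  have h1 := (hg.differentiableOn (by simp) (t, x) ⟨ht, mem_univ x⟩).hasFDerivWithinAt
  have h2 : HasDerivWithinAt (fun τ : ℝ => (τ, x)) ((1 : ℝ), (0 : ℝ)) (Icc 0 T) t :=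
    (hasDerivWithinAt_id t _).prodMk (hasDerivWithinAt_const t _ x)
  exact h1.comp_hasDerivWithinAt t h2 fun τ hτ => mk_mem_prod hτ (mem_univ x)

theorem continuous_slice {g : ℝ × ℝ → ℂ} (hg : ContinuousOn g (Icc 0 T ×ˢ univ)) {t : ℝ}
    (ht : t ∈ Icc 0 T) : Continuous fun x => g (t, x) :=
  hg.comp_continuous (f := fun x : ℝ => (t, x)) (by fun_prop)
    fun x => mk_mem_prod ht (mem_univ x)

theorem exists_slab_bound {g : ℝ × ℝ → ℂ} (hg : ContinuousOn g (Icc 0 T ×ˢ univ)) :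
    ∃ C, ∀ t ∈ Icc 0 T, ∀ x ∈ Icc 0 (2 * Real.pi), ‖g (t, x)‖ ≤ C := by
  obtain ⟨C, hC⟩ := (isCompact_Icc.prod isCompact_Icc).exists_bound_of_continuousOn
    (hg.mono (prod_mono (subset_refl (Icc 0 T)) (subset_univ (Icc 0 (2 * Real.pi)))))
  exact ⟨C, fun t ht x hx => hC (t, x) ⟨ht, hx⟩⟩

theorem continuousOn_fourierCoef_slice (hT : 0 < T) {g : ℝ × ℝ → ℂ}
    (hg : ContinuousOn g (Icc 0 T ×ˢ univ)) (k : ℤ) :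
    ContinuousOn (fun t => fourierCoef (fun x => g (t, x)) k) (Icc 0 T) := by
  -- Freezing g in time outside [0,T] makes it continuous on the whole plane, where continuity of
  -- parametric integrals is available.
  have h1 : Continuous fun p : ℝ × ℝ => g ((projIcc 0 T hT.le p.1 : ℝ), p.2) := by
    refine hg.comp_continuous ?_ fun p => ⟨(projIcc 0 T hT.le p.1).2, mem_univ _⟩
    exact (continuous_subtype_val.comp (continuous_projIcc.comp continuous_fst)).prodMk
      continuous_snd
  have h2 : Continuous fun t : ℝ =>
      fourierCoef (fun x => g ((projIcc 0 T hT.le t : ℝ), x)) k := by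
    refine intervalIntegral.continuous_parametric_intervalIntegral_of_continuous'
      (μ := MeasureTheory.volume) (f := fun t x =>
      Complex.exp (-(Complex.I * k * x)) * g ((projIcc 0 T hT.le t : ℝ), x)) ?_ 0 (2 * Real.pi)
    exact Continuous.mul (by fun_prop) h1
  refine h2.continuousOn.congr fun t ht => ?_
  simp only [projIcc_of_mem hT.le ht]

theorem hasDerivAt_fourierCoef_slice (hT : 0 < T) {g : ℝ × ℝ → ℂ}
    (hg : ContDiffOn ℝ ∞ g (Icc 0 T ×ˢ univ)) (k : ℤ) {t : ℝ} (ht : t ∈ Ioo 0 T) :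
    HasDerivAt (fun τ => fourierCoef (fun x => g (τ, x)) k)
      (fourierCoef (fun x => slabDerivT T g (t, x)) k) t := by
  have hg' := (contDiffOn_slabDerivT hT hg).continuousOn
  obtain ⟨C, hC⟩ := exists_slab_bound hg'
  have hp : (0 : ℝ) ≤ 2 * Real.pi := by positivity
  have hmeas : ∀ {G : ℝ × ℝ → ℂ}, ContinuousOn G (Icc 0 T ×ˢ univ) → ∀ τ ∈ Ioo 0 T,
      Continuous fun x : ℝ => Complex.exp (-(Complex.I * k * x)) * G (τ, x) := by
    intro G hG τ hτ
    exact Continuous.mul (by fun_prop) (continuous_slice hG (Ioo_subset_Icc_self hτ))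
  refine (intervalIntegral.hasDerivAt_integral_of_dominated_loc_of_deriv_le
    (F := fun τ x => Complex.exp (-(Complex.I * k * x)) * g (τ, x))
    (F' := fun τ x => Complex.exp (-(Complex.I * k * x)) * slabDerivT T g (τ, x))
    (bound := fun _ => C) (Ioo_mem_nhds ht.1 ht.2) ?_ ?_ ?_ ?_ ?_ ?_).2
  · filter_upwards [Ioo_mem_nhds ht.1 ht.2] with τ hτ
    exact (hmeas hg.continuousOn τ hτ).aestronglyMeasurable
  · exact (hmeas hg.continuousOn t ht).intervalIntegrable _ _
  · exact (hmeas hg' t ht).aestronglyMeasurable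
  · refine Filter.Eventually.of_forall fun x hx τ hτ => ?_
    rw [uIoc_of_le hp] at hx
    rw [norm_mul, norm_char_neg, one_mul]
    exact hC τ (Ioo_subset_Icc_self hτ) x ⟨hx.1.le, hx.2⟩
  · exact intervalIntegrable_const
  · refine Filter.Eventually.of_forall fun x _ τ hτ => ?_
    exact ((hasDerivWithinAt_slabDerivT hg (Ioo_subset_Icc_self hτ) x).hasDerivAt
      (Icc_mem_nhds hτ.1 hτ.2)).const_mul _

theorem fourierCoef_deriv {f f' : ℝ → ℂ} (hf : ∀ x, HasDerivAt f (f' x) x) (hf' : Continuous f')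
    (hp : Function.Periodic f (2 * Real.pi)) (k : ℤ) :
    fourierCoef f' k = Complex.I * k * fourierCoef f k := by
  have he (x : ℝ) : HasDerivAt (fun y : ℝ => Complex.exp (-(Complex.I * k * y)))
      (Complex.exp (-(Complex.I * k * x)) * (-(Complex.I * k))) x := by
    have h1 : HasDerivAt (fun y : ℝ => -(Complex.I * k * (y : ℂ))) (-(Complex.I * k * 1)) x :=
      ((hasDerivAt_id x).ofReal_comp.const_mul (Complex.I * k)).neg
    simpa using h1.cexp
  have h := intervalIntegral.integral_mul_deriv_eq_deriv_mul (a := 0) (b := 2 * Real.pi)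
    (u := fun y : ℝ => Complex.exp (-(Complex.I * k * y)))
    (u' := fun x : ℝ => Complex.exp (-(Complex.I * k * x)) * (-(Complex.I * k)))
    (v := f) (v' := f') (fun x _ => he x) (fun x _ => hf x)
    (Continuous.intervalIntegrable (by fun_prop) _ _) (hf'.intervalIntegrable _ _)
  have h0 : f (2 * Real.pi) = f 0 := by simpa using hp 0
  have h1 : Complex.exp (-(Complex.I * k * ((2 * Real.pi : ℝ) : ℂ))) = 1 := by
    have := periodic_char k 0
    simp only [zero_add] at this
    rw [Complex.exp_neg, this]
    simp
  rw [fourierCoef, h, h1, h0, fourierCoef, ← intervalIntegral.integral_const_mul]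
  simp only [Complex.ofReal_zero, mul_zero, neg_zero, Complex.exp_zero, sub_self, zero_sub,
    ← intervalIntegral.integral_neg]
  congr 1
  funext x
  ring

/-- G is the n-th spatial derivative of g. Only its smoothness on the slab and its coefficients
matter later. -/
theorem exists_fourierCoef_pow_mul (hT : 0 < T) (n : ℕ) : ∀ {g : ℝ × ℝ → ℂ},
    ContDiffOn ℝ ∞ g (Icc 0 T ×ˢ univ) →
    (∀ t ∈ Icc 0 T, Function.Periodic (fun x => g (t, x)) (2 * Real.pi)) →
    ∃ G : ℝ × ℝ → ℂ, ContDiffOn ℝ ∞ G (Icc 0 T ×ˢ univ) ∧ ∀ t ∈ Icc 0 T, ∀ k : ℤ,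
      fourierCoef (fun x => G (t, x)) k =
        (Complex.I * k) ^ n * fourierCoef (fun x => g (t, x)) k := by
  induction n with
  | zero => exact fun {g} hg _ => ⟨g, hg, fun t _ k => by simp⟩
  | succ n ih =>
    intro g hg hp
    have hX := contDiffOn_slabDerivX hT hg
    have hpX : ∀ t ∈ Icc 0 T,
        Function.Periodic (fun x => slabDerivX T g (t, x)) (2 * Real.pi) := by
      intro t ht x
      have h1 := (hasDerivAt_slabDerivX hg ht (x + 2 * Real.pi)).comp_add_const x (2 * Real.pi)
      have h2 : (fun y => g (t, y + 2 * Real.pi)) = fun y => g (t, y) := funext (hp t ht)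
      rw [h2] at h1
      exact h1.unique (hasDerivAt_slabDerivX hg ht x)
    obtain ⟨G, hG, hGk⟩ := ih hX hpX
    refine ⟨G, hG, fun t ht k => ?_⟩
    rw [hGk t ht k, fourierCoef_deriv (hasDerivAt_slabDerivX hg ht)
      (continuous_slice hX.continuousOn ht) (hp t ht) k]
    ring

/-- Four integrations by parts, uniformly in time by compactness. Order four suffices because the
series must still converge after multiplication by |k|^{2α} ≤ 1 + k². -/
theorem exists_fourierCoef_decay (hT : 0 < T) {g : ℝ × ℝ → ℂ}
    (hg : ContDiffOn ℝ ∞ g (Icc 0 T ×ˢ univ))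
    (hp : ∀ t ∈ Icc 0 T, Function.Periodic (fun x => g (t, x)) (2 * Real.pi)) :
    ∃ C, ∀ t ∈ Icc 0 T, ∀ k : ℤ,
      ‖fourierCoef (fun x => g (t, x)) k‖ ≤ C * ((1 + (k : ℝ) ^ 2) ^ 2)⁻¹ := by
  obtain ⟨G, hG, hGk⟩ := exists_fourierCoef_pow_mul hT 4 hg hp
  obtain ⟨C₀, hC₀⟩ := exists_slab_bound hg.continuousOn
  obtain ⟨C₄, hC₄⟩ := exists_slab_bound hG.continuousOn
  refine ⟨2 * (2 * Real.pi * C₀ + 2 * Real.pi * C₄), fun t ht k => ?_⟩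
  have h0 := norm_fourierCoef_le (hC₀ t ht) k
  have h4 := norm_fourierCoef_le (hC₄ t ht) k
  rw [hGk t ht k, norm_mul, norm_pow, norm_mul, Complex.norm_I, one_mul, Complex.norm_intCast,
    Even.pow_abs ⟨2, rfl⟩] at h4
  rw [← div_eq_mul_inv, le_div_iff₀ (by positivity)]
  have hn := norm_nonneg (fourierCoef (fun x => g (t, x)) k)
  have hk : (1 + (k : ℝ) ^ 2) ^ 2 ≤ 2 * (1 + (k : ℝ) ^ 4) := by
    nlinarith [sq_nonneg ((k : ℝ) ^ 2 - 1)]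
  calc _ ≤ ‖fourierCoef (fun x => g (t, x)) k‖ * (2 * (1 + (k : ℝ) ^ 4)) := by gcongr
    _ ≤ _ := by norm_num at h4; linarith

end Slab

/-! ### The equation on the Fourier side -/

theorem summable_inv_one_add_sq : Summable fun k : ℤ => (1 + (k : ℝ) ^ 2)⁻¹ := by
  have h : Summable fun k : ℤ => 1 / (k : ℝ) ^ 2 := Real.summable_one_div_int_pow.2 one_lt_two
  refine h.of_norm_bounded_eventually ?_
  filter_upwards [(Set.finite_singleton (0 : ℤ)).compl_mem_cofinite] with k hk
  have hk' : (k : ℝ) ≠ 0 := Int.cast_ne_zero.2 hk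
  rw [Real.norm_of_nonneg (by positivity), one_div]
  gcongr
  linarith

theorem summable_inv_one_add_sq_sq : Summable fun k : ℤ => ((1 + (k : ℝ) ^ 2) ^ 2)⁻¹ := by
  refine summable_inv_one_add_sq.of_nonneg_of_le (fun k => by positivity) fun k => ?_
  gcongr
  nlinarith [sq_nonneg (k : ℝ)]

theorem fourierCoef_fracLaplacian {α : ℝ} {f : ℝ → ℂ}
    (h : Summable fun k : ℤ => |(k : ℝ)| ^ (2 * α) * ‖fourierCoef f k‖) (k : ℤ) :
    fourierCoef (fracLaplacian α f) k = ((|(k : ℝ)| ^ (2 * α) : ℝ) : ℂ) * fourierCoef f k := by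
  have h1 := fourierCoef_tsum_char (c := fun k : ℤ => ((|(k : ℝ)| ^ (2 * α) : ℝ) : ℂ) *
    fourierCoef f k) (by
      refine h.congr fun k => ?_
      rw [norm_mul, Complex.norm_real, Real.norm_of_nonneg (by positivity)]) k
  have hπ : (Real.pi : ℂ) ≠ 0 := Complex.ofReal_ne_zero.2 Real.pi_ne_zero
  unfold fracLaplacian
  rw [fourierCoef_const_mul, h1]
  field_simp

/-- The `k`-th Fourier coefficient of the nonlinear term `|u|² u`. -/
def nonlinearCoef (f : ℝ → ℂ) (k : ℤ) : ℂ := fourierCoef (fun x => (‖f x‖ : ℂ) ^ 2 * f x) k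

theorem continuousOn_cubic {u : ℝ → ℝ → ℂ} {s : Set (ℝ × ℝ)}
    (hu : ContinuousOn (fun p : ℝ × ℝ => u p.1 p.2) s) :
    ContinuousOn (fun p : ℝ × ℝ => (‖u p.1 p.2‖ : ℂ) ^ 2 * u p.1 p.2) s :=
  ((Complex.continuous_ofReal.comp_continuousOn hu.norm).pow 2).mul hu

namespace IsSmoothSolution

variable {α T : ℝ} {φ : ℝ → ℂ} {u : ℝ → ℝ → ℂ}

theorem decay (hT : 0 < T) (h : IsSmoothSolution α T φ u) :
    ∃ C, ∀ t ∈ Icc 0 T, ∀ k : ℤ, ‖fourierCoef (u t) k‖ ≤ C * ((1 + (k : ℝ) ^ 2) ^ 2)⁻¹ :=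
  exists_fourierCoef_decay hT h.smooth h.periodic

theorem isWiener (hT : 0 < T) (h : IsSmoothSolution α T φ u) {t : ℝ} (ht : t ∈ Icc 0 T) :
    IsWiener (u t) := by
  obtain ⟨C, hC⟩ := h.decay hT
  exact ⟨continuous_slice h.smooth.continuousOn ht, h.periodic t ht,
    (summable_inv_one_add_sq_sq.mul_left C).of_nonneg_of_le (fun _ => norm_nonneg _) (hC t ht)⟩

/-- The decay is uniform in time, so the series of continuous functions converges uniformly. This
continuity is what the bootstrap requires. -/
theorem continuousOn_wienerNorm (hT : 0 < T) (h : IsSmoothSolution α T φ u) :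
    ContinuousOn (fun t => wienerNorm (u t)) (Icc 0 T) := by
  obtain ⟨C, hC⟩ := h.decay hT
  refine continuousOn_tsum
    (fun k => (continuousOn_fourierCoef_slice hT h.smooth.continuousOn k).norm)
    (summable_inv_one_add_sq_sq.mul_left C) fun k t ht => ?_
  rw [norm_norm]
  exact hC t ht k

theorem summable_symbol_mul (hT : 0 < T) (hα₀ : 0 < α) (hα : α < 1)
    (h : IsSmoothSolution α T φ u) {t : ℝ} (ht : t ∈ Icc 0 T) :
    Summable fun k : ℤ => |(k : ℝ)| ^ (2 * α) * ‖fourierCoef (u t) k‖ := by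
  obtain ⟨C, hC⟩ := h.decay hT
  refine (summable_inv_one_add_sq.mul_left C).of_nonneg_of_le (fun k => by positivity) fun k => ?_
  have h1 : |(k : ℝ)| ^ (2 * α) ≤ 1 + (k : ℝ) ^ 2 := by
    rcases eq_or_ne k 0 with rfl | hk
    · rw [Int.cast_zero, abs_zero, Real.zero_rpow (by linarith)]
      norm_num
    · have hk1 : 1 ≤ |(k : ℝ)| := by exact_mod_cast Int.one_le_abs hk
      calc |(k : ℝ)| ^ (2 * α) ≤ |(k : ℝ)| ^ (2 : ℝ) :=
            Real.rpow_le_rpow_of_exponent_le hk1 (by linarith)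
        _ ≤ _ := by rw [Real.rpow_two, sq_abs]; linarith
  calc _ ≤ (1 + (k : ℝ) ^ 2) * (C * ((1 + (k : ℝ) ^ 2) ^ 2)⁻¹) :=
        mul_le_mul h1 (hC t ht k) (norm_nonneg _) (by positivity)
    _ = _ := by field_simp

theorem fourierCoef_slabDerivT (hT : 0 < T) (hα₀ : 0 < α) (hα : α < 1)
    (h : IsSmoothSolution α T φ u) {t : ℝ} (ht : t ∈ Icc 0 T) (k : ℤ) :
    fourierCoef (fun x => slabDerivT T (fun p => u p.1 p.2) (t, x)) k =
      Complex.I * (((|(k : ℝ)| ^ (2 * α) : ℝ) : ℂ) * fourierCoef (u t) k +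
        nonlinearCoef (u t) k) := by
  have hc1 : Continuous fun x => slabDerivT T (fun p => u p.1 p.2) (t, x) :=
    continuous_slice (contDiffOn_slabDerivT hT h.smooth).continuousOn ht
  have hc2 : Continuous fun x => (‖u t x‖ : ℂ) ^ 2 * u t x :=
    continuous_slice (continuousOn_cubic h.smooth.continuousOn) ht
  have heq (x : ℝ) : fracLaplacian α (u t) x =
      -Complex.I * slabDerivT T (fun p => u p.1 p.2) (t, x) - (‖u t x‖ : ℂ) ^ 2 * u t x := by
    have h1 := h.equation t ht x
    rw [(hasDerivWithinAt_slabDerivT h.smooth ht x).derivWithin (uniqueDiffOn_Icc hT t ht)] at h1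
    linear_combination h1
  have h2 := fourierCoef_fracLaplacian (h.summable_symbol_mul hT hα₀ hα ht) k
  rw [fourierCoef_congr heq, fourierCoef_sub (by fun_prop) hc2,
    fourierCoef_const_mul] at h2
  rw [← h2, nonlinearCoef]
  linear_combination fourierCoef (fun x => slabDerivT T (fun p => u p.1 p.2) (t, x)) k *
    Complex.I_sq

/-- Duhamel's formula for the Fourier coefficients of a smooth solution. -/
theorem duhamel (hT : 0 < T) (hα₀ : 0 < α) (hα : α < 1)
    (h : IsSmoothSolution α T φ u) {t : ℝ} (ht : t ∈ Icc 0 T) (k : ℤ) :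
    Complex.exp (-(Complex.I * (|(k : ℝ)| ^ (2 * α) : ℝ) * t)) * fourierCoef (u t) k =
      fourierCoef φ k + ∫ τ in (0 : ℝ)..t,
        Complex.I * (Complex.exp (-(Complex.I * (|(k : ℝ)| ^ (2 * α) : ℝ) * τ)) *
          nonlinearCoef (u τ) k) := by
  set ν : ℝ := |(k : ℝ)| ^ (2 * α) with hν
  have hsub : Icc 0 t ⊆ Icc 0 T := Icc_subset_Icc_right ht.2
  have hcv : ContinuousOn (fun τ => fourierCoef (u τ) k) (Icc 0 t) :=
    (continuousOn_fourierCoef_slice hT h.smooth.continuousOn k).mono hsub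
  have hcN : ContinuousOn (fun τ => nonlinearCoef (u τ) k) (Icc 0 t) :=
    (continuousOn_fourierCoef_slice hT (continuousOn_cubic h.smooth.continuousOn) k).mono hsub
  have hexp : Continuous fun τ : ℝ => Complex.exp (-(Complex.I * ν * τ)) := by fun_prop
  have hint : IntervalIntegrable (fun τ : ℝ => Complex.I * (Complex.exp (-(Complex.I * ν * τ)) *
      nonlinearCoef (u τ) k)) MeasureTheory.volume 0 t := by
    refine ContinuousOn.intervalIntegrable ?_
    rw [uIcc_of_le ht.1]
    exact continuousOn_const.mul (hexp.continuousOn.mul hcN)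
  have hmain := intervalIntegral.integral_eq_sub_of_hasDerivAt_of_le ht.1
    (f := fun τ : ℝ => Complex.exp (-(Complex.I * ν * τ)) * fourierCoef (u τ) k)
    (hexp.continuousOn.mul hcv) (fun τ hτ => ?_) hint
  · have h0 : fourierCoef (u 0) k = fourierCoef φ k := fourierCoef_congr h.initial k
    rw [hmain, h0]
    simp
  · have hτ' : τ ∈ Ioo 0 T := ⟨hτ.1, hτ.2.trans_le ht.2⟩
    have h1 := hasDerivAt_fourierCoef_slice hT h.smooth k hτ'
    rw [h.fourierCoef_slabDerivT hT hα₀ hα (Ioo_subset_Icc_self hτ') k, ← hν] at h1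
    have h2 : HasDerivAt (fun y : ℝ => Complex.exp (-(Complex.I * ν * y)))
        (Complex.exp (-(Complex.I * ν * τ)) * (-(Complex.I * ν))) τ := by
      have h3 : HasDerivAt (fun y : ℝ => -(Complex.I * ν * (y : ℂ))) (-(Complex.I * ν * 1)) τ :=
        ((hasDerivAt_id τ).ofReal_comp.const_mul (Complex.I * ν)).neg
      simpa using h3.cexp
    convert! h2.mul h1 using 1
    ring

end IsSmoothSolution

/-! ### A priori estimates in the Wiener norm -/

theorem norm_exp_neg_I_mul (a t : ℝ) : ‖Complex.exp (-(Complex.I * a * t))‖ = 1 := by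
  have h : -(Complex.I * a * t) = ((-(a * t) : ℝ) : ℂ) * Complex.I := by push_cast; ring
  rw [h, Complex.norm_exp_ofReal_mul_I]

theorem norm_exp_I_mul (a t : ℝ) : ‖Complex.exp (Complex.I * a * t)‖ = 1 := by
  have h : Complex.I * a * t = ((a * t : ℝ) : ℂ) * Complex.I := by push_cast; ring
  rw [h, Complex.norm_exp_ofReal_mul_I]

theorem norm_cubic_sub_le {a b : ℂ} {M : ℝ} (ha : ‖a‖ ≤ M) (hb : ‖b‖ ≤ M) :
    ‖(‖a‖ : ℂ) ^ 2 * a - (‖b‖ : ℂ) ^ 2 * b‖ ≤ 3 * M ^ 2 * ‖a - b‖ := by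
  have hM : 0 ≤ M := (norm_nonneg a).trans ha
  have h : (‖a‖ : ℂ) ^ 2 * a - (‖b‖ : ℂ) ^ 2 * b =
      (‖a‖ : ℂ) ^ 2 * (a - b) + ((‖a‖ - ‖b‖ : ℝ) : ℂ) * ((‖a‖ + ‖b‖ : ℝ) : ℂ) * b := by
    push_cast
    ring
  have h1 : |‖a‖ - ‖b‖| ≤ ‖a - b‖ := abs_norm_sub_norm_le a b
  have h2 : |‖a‖ + ‖b‖| ≤ 2 * M := by
    rw [abs_of_nonneg (by positivity)]
    linarith
  rw [h]
  refine (norm_add_le _ _).trans ?_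
  rw [norm_mul, norm_mul, norm_mul, norm_pow, Complex.norm_real, Complex.norm_real,
    Complex.norm_real, norm_norm, Real.norm_eq_abs, Real.norm_eq_abs]
  calc ‖a‖ ^ 2 * ‖a - b‖ + |‖a‖ - ‖b‖| * |‖a‖ + ‖b‖| * ‖b‖
      ≤ M ^ 2 * ‖a - b‖ + ‖a - b‖ * (2 * M) * M := by gcongr
    _ = _ := by ring

/-- A first-time (continuity) argument on `[0,T]`. -/
theorem le_two_mul_of_bootstrap {T a : ℝ} {w : ℝ → ℝ} (hw : ContinuousOn w (Icc 0 T))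
    (h : ∀ t ∈ Icc 0 T, (∀ τ ∈ Ico 0 t, w τ ≤ 2 * a) → w t < 2 * a) :
    ∀ t ∈ Icc 0 T, w t ≤ 2 * a := by
  by_contra! hcon
  obtain ⟨t₁, ht₁, hw₁⟩ := hcon
  -- The times at which w has reached 2a form a compact set; its least element contradicts the
  -- strict improvement in `h`.
  let S : Set ℝ := Icc 0 T ∩ w ⁻¹' Ici (2 * a)
  have hS : IsCompact S := isCompact_Icc.of_isClosed_subset
    (hw.preimage_isClosed_of_isClosed isClosed_Icc isClosed_Ici) inter_subset_left
  obtain ⟨t₀, ⟨ht₀, hwt₀⟩, hmin⟩ := hS.exists_isLeast ⟨t₁, ht₁, hw₁.le⟩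
  have hlt : ∀ τ ∈ Ico 0 t₀, w τ < 2 * a := by
    intro τ hτ
    by_contra! hge
    exact absurd (hmin ⟨⟨hτ.1, hτ.2.le.trans ht₀.2⟩, hge⟩) (not_le.2 hτ.2)
  exact absurd (h t₀ ht₀ fun τ hτ => (hlt τ hτ).le) (not_lt.2 hwt₀)

/-- The frequency `|k|^{2α}` of the `k`-th mode of the linear evolution. -/
def symbol (α : ℝ) (k : ℤ) : ℝ := |(k : ℝ)| ^ (2 * α)

theorem IsWiener.sub {f g : ℝ → ℂ} (hf : IsWiener f) (hg : IsWiener g) :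
    IsWiener fun x => f x - g x where
  continuous := hf.continuous.sub hg.continuous
  periodic x := by simp only [hf.periodic x, hg.periodic x]
  summable := by
    refine (hf.summable.add hg.summable).of_nonneg_of_le (fun _ => norm_nonneg _) fun k => ?_
    rw [fourierCoef_sub hf.continuous hg.continuous]
    exact norm_sub_le _ _

theorem IsWiener.const_mul {f : ℝ → ℂ} (hf : IsWiener f) (c : ℂ) : IsWiener fun x => c * f x where
  continuous := continuous_const.mul hf.continuous
  periodic x := by simp only [hf.periodic x]
  summable := by
    simp only [fourierCoef_const_mul, norm_mul]
    exact hf.summable.mul_left _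

theorem wienerNorm_const_mul (f : ℝ → ℂ) (c : ℂ) :
    wienerNorm (fun x => c * f x) = ‖c‖ * wienerNorm f := by
  simp only [wienerNorm, fourierCoef_const_mul, norm_mul, tsum_mul_left]

namespace IsSmoothSolution

variable {α T : ℝ} {φ : ℝ → ℂ} {u : ℝ → ℝ → ℂ}

theorem continuousOn_nonlinearCoef (hT : 0 < T) (h : IsSmoothSolution α T φ u) (k : ℤ) :
    ContinuousOn (fun τ => nonlinearCoef (u τ) k) (Icc 0 T) :=
  continuousOn_fourierCoef_slice hT (continuousOn_cubic h.smooth.continuousOn) k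

theorem fourierCoef_eq (hT : 0 < T) (hα₀ : 0 < α) (hα : α < 1)
    (h : IsSmoothSolution α T φ u) {t : ℝ} (ht : t ∈ Icc 0 T) (k : ℤ) :
    fourierCoef (u t) k - Complex.exp (Complex.I * symbol α k * t) * fourierCoef φ k =
      Complex.exp (Complex.I * symbol α k * t) * ∫ τ in (0 : ℝ)..t,
        Complex.I * (Complex.exp (-(Complex.I * symbol α k * τ)) * nonlinearCoef (u τ) k) := by
  have h1 := h.duhamel hT hα₀ hα ht k
  have h2 : Complex.exp (Complex.I * symbol α k * t) *
      Complex.exp (-(Complex.I * symbol α k * t)) = 1 := by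
    rw [← Complex.exp_add, add_neg_cancel, Complex.exp_zero]
  change Complex.exp (-(Complex.I * symbol α k * t)) * fourierCoef (u t) k = _ at h1
  unfold symbol at h2 ⊢
  unfold symbol at h1
  linear_combination Complex.exp (Complex.I * ((|(k : ℝ)| ^ (2 * α) : ℝ) : ℂ) * t) * h1 -
    fourierCoef (u t) k * h2

/-- By Duhamel the deviation from the linear flow is a time integral of the cubic term, whose Wiener
norm is at most (2π)⁻² W³. Finite sums over k commute with the integral without further
justification; the bound on W is needed only before time t, as the bootstrap demands. -/
theorem sum_norm_sub_linear_le (hT : 0 < T) (hα₀ : 0 < α) (hα : α < 1)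
    (h : IsSmoothSolution α T φ u) {t W : ℝ} (ht : t ∈ Icc 0 T) (hW₀ : 0 ≤ W)
    (hW : ∀ τ ∈ Ico 0 t, wienerNorm (u τ) ≤ W) (F : Finset ℤ) :
    ∑ k ∈ F, ‖fourierCoef (u t) k - Complex.exp (Complex.I * symbol α k * t) * fourierCoef φ k‖ ≤
      T * (((2 * Real.pi)⁻¹) ^ 2 * W ^ 3) := by
  have hsub : Icc 0 t ⊆ Icc 0 T := Icc_subset_Icc_right ht.2
  have hcont (k : ℤ) : ContinuousOn (fun τ => ‖nonlinearCoef (u τ) k‖) (uIcc 0 t) := by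
    rw [uIcc_of_le ht.1]
    exact ((h.continuousOn_nonlinearCoef hT k).mono hsub).norm
  have hstep (k : ℤ) : ‖fourierCoef (u t) k -
      Complex.exp (Complex.I * symbol α k * t) * fourierCoef φ k‖ ≤
        ∫ τ in (0 : ℝ)..t, ‖nonlinearCoef (u τ) k‖ := by
    rw [h.fourierCoef_eq hT hα₀ hα ht k, norm_mul, norm_exp_I_mul, one_mul]
    refine (intervalIntegral.norm_integral_le_integral_norm ht.1).trans_eq ?_
    simp only [norm_mul, Complex.norm_I, norm_exp_neg_I_mul, one_mul]
  refine (Finset.sum_le_sum fun k _ => hstep k).trans ?_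
  rw [← intervalIntegral.integral_finsetSum fun k _ => (hcont k).intervalIntegrable]
  have hmono := intervalIntegral.integral_mono_on_of_le_Ioo (μ := MeasureTheory.volume) ht.1
    (f := fun τ => ∑ k ∈ F, ‖nonlinearCoef (u τ) k‖)
    (g := fun _ => ((2 * Real.pi)⁻¹) ^ 2 * W ^ 3)
    (ContinuousOn.intervalIntegrable (continuousOn_finsetSum _ fun k _ => hcont k))
    intervalIntegrable_const (by
      intro τ hτ
      have hc := (h.isWiener hT (hsub (Ioo_subset_Icc_self hτ))).cubic
      refine (hc.1.summable.sum_le_tsum F fun _ _ => norm_nonneg _).trans (hc.2.trans ?_)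
      have := hW τ (Ioo_subset_Ico_self hτ)
      have := wienerNorm_nonneg (u τ)
      gcongr)
  refine hmono.trans ?_
  rw [intervalIntegral.integral_const, sub_zero, smul_eq_mul]
  have := ht.2
  gcongr

end IsSmoothSolution

/-- The linear evolution of the sum of the modes `e^{ikx} / 2π`, `k ∈ S`. -/
def linearWave (α : ℝ) (S : Finset ℤ) (t x : ℝ) : ℂ :=
  ∑ k ∈ S, (2 * Real.pi : ℂ)⁻¹ * Complex.exp (Complex.I * symbol α k * t) *
    Complex.exp (Complex.I * k * x)

/-! ### The linear evolution of a finite sum of modes -/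

section LinearWave

variable (α : ℝ) (S : Finset ℤ) (t : ℝ)

theorem continuous_linearWave : Continuous fun p : ℝ × ℝ => linearWave α S p.1 p.2 := by
  unfold linearWave
  fun_prop

theorem contDiff_linearWave : ContDiff ℝ ∞ (linearWave α S t) := by
  unfold linearWave
  refine ContDiff.sum fun k _ => contDiff_const.mul ?_
  exact (contDiff_const.mul Complex.ofRealCLM.contDiff).cexp

theorem periodic_linearWave : Function.Periodic (linearWave α S t) (2 * Real.pi) := by
  intro x
  refine Finset.sum_congr rfl fun k _ => ?_
  exact congrArg _ (periodic_char k x)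

theorem fourierCoef_finsetSum {ι : Type*} (F : Finset ι) {f : ι → ℝ → ℂ}
    (hf : ∀ i ∈ F, Continuous (f i)) (k : ℤ) :
    fourierCoef (fun x => ∑ i ∈ F, f i x) k = ∑ i ∈ F, fourierCoef (f i) k := by
  simp only [fourierCoef, Finset.mul_sum]
  exact intervalIntegral.integral_finsetSum fun i hi =>
    intervalIntegrable_char_mul ((hf i hi).intervalIntegrable _ _) k

theorem fourierCoef_linearWave (k : ℤ) :
    fourierCoef (linearWave α S t) k =
      if k ∈ S then Complex.exp (Complex.I * symbol α k * t) else 0 := by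
  unfold linearWave
  rw [fourierCoef_finsetSum S fun l _ => by fun_prop]
  have hπ : (Real.pi : ℂ) ≠ 0 := Complex.ofReal_ne_zero.2 Real.pi_ne_zero
  simp only [fourierCoef_const_mul, fourierCoef_char, mul_ite, mul_zero, Finset.sum_ite_eq']
  split_ifs
  · field_simp
  · rfl

theorem norm_fourierCoef_linearWave (k : ℤ) :
    ‖fourierCoef (linearWave α S t) k‖ = if k ∈ S then 1 else 0 := by
  rw [fourierCoef_linearWave]
  split_ifs
  · rw [norm_exp_I_mul]
  · exact norm_zero

theorem isWiener_linearWave : IsWiener (linearWave α S t) where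
  continuous := (contDiff_linearWave α S t).continuous
  periodic := periodic_linearWave α S t
  summable := by
    refine summable_of_ne_finset_zero (s := S) fun k hk => ?_
    rw [norm_fourierCoef_linearWave, if_neg hk]

theorem wienerNorm_linearWave : wienerNorm (linearWave α S t) = S.card := by
  simp only [wienerNorm, norm_fourierCoef_linearWave]
  rw [tsum_eq_sum (s := S) fun k hk => if_neg hk, Finset.sum_ite_mem, Finset.inter_self]
  simp

end LinearWave

/-! ### Expansion of the solution in the size of the data -/

theorem wienerNorm_le_of_sum_sub_le {f g : ℝ → ℂ} {c : ℤ → ℂ} {R : ℝ} (hc : ∀ k, ‖c k‖ = 1)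
    (hg : IsWiener g)
    (h : ∀ F : Finset ℤ, ∑ k ∈ F, ‖fourierCoef f k - c k * fourierCoef g k‖ ≤ R) :
    wienerNorm f ≤ wienerNorm g + R := by
  refine Real.tsum_le_of_sum_le (fun _ => norm_nonneg _) fun F => ?_
  have hk (k : ℤ) : ‖fourierCoef f k‖ ≤
      ‖fourierCoef g k‖ + ‖fourierCoef f k - c k * fourierCoef g k‖ := by
    have h1 := norm_add_le (c k * fourierCoef g k) (fourierCoef f k - c k * fourierCoef g k)
    rwa [add_sub_cancel, norm_mul, hc, one_mul] at h1
  refine (Finset.sum_le_sum fun k _ => hk k).trans ?_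
  rw [Finset.sum_add_distrib]
  exact add_le_add (hg.summable.sum_le_tsum F fun _ _ => norm_nonneg _) (h F)

/-- The `k`-th Fourier coefficient at time `T` of the cubic Picard iterate, up to the factor
`e^{i T |k|^{2α}}`. -/
def cubicTerm (α T : ℝ) (S : Finset ℤ) (k : ℤ) : ℂ :=
  ∫ τ in (0 : ℝ)..T, Complex.I * (Complex.exp (-(Complex.I * symbol α k * τ)) *
    nonlinearCoef (linearWave α S τ) k)

theorem continuous_nonlinearCoef_linearWave (α : ℝ) (S : Finset ℤ) (k : ℤ) :
    Continuous fun τ => nonlinearCoef (linearWave α S τ) k := by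
  refine intervalIntegral.continuous_parametric_intervalIntegral_of_continuous'
    (μ := MeasureTheory.volume) (f := fun t x => Complex.exp (-(Complex.I * k * x)) *
      ((‖linearWave α S t x‖ : ℂ) ^ 2 * linearWave α S t x)) ?_ 0 (2 * Real.pi)
  have hc := continuous_linearWave α S
  exact Continuous.mul (by fun_prop)
    (((Complex.continuous_ofReal.comp hc.norm).pow 2).mul hc)

theorem nonlinearCoef_smul (ε : ℝ) (f : ℝ → ℂ) (k : ℤ) :
    nonlinearCoef (fun x => ε * f x) k = (ε : ℂ) ^ 3 * nonlinearCoef f k := by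
  rw [nonlinearCoef, nonlinearCoef, ← fourierCoef_const_mul]
  refine fourierCoef_congr (fun x => ?_) k
  rw [norm_mul, Complex.norm_real, Real.norm_eq_abs, Complex.ofReal_mul, mul_pow,
    ← Complex.ofReal_pow, sq_abs]
  push_cast
  ring

theorem norm_nonlinearCoef_sub_le {f g : ℝ → ℂ} (hf : Continuous f) (hg : Continuous g) {M D : ℝ}
    (hfM : ∀ x, ‖f x‖ ≤ M) (hgM : ∀ x, ‖g x‖ ≤ M) (hD : ∀ x, ‖f x - g x‖ ≤ D) (k : ℤ) :
    ‖nonlinearCoef f k - nonlinearCoef g k‖ ≤ 2 * Real.pi * (3 * M ^ 2 * D) := by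
  rw [nonlinearCoef, nonlinearCoef, ← fourierCoef_sub (by fun_prop) (by fun_prop)]
  refine norm_fourierCoef_le (fun x _ => ?_) k
  refine (norm_cubic_sub_le (hfM x) (hgM x)).trans ?_
  exact mul_le_mul_of_nonneg_left (hD x) (by positivity)

namespace IsSmoothSolution

variable {α T : ℝ} {φ : ℝ → ℂ} {u : ℝ → ℝ → ℂ}

/-- The linear flow preserves the Wiener norm, and `hsmall` makes the Duhamel term smaller than a as
long as the norm stays below 2a, so the bootstrap closes. -/
theorem wienerNorm_le (hT : 0 < T) (hα₀ : 0 < α) (hα : α < 1)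
    (h : IsSmoothSolution α T φ u) {a : ℝ} (ha₀ : 0 < a) (ha : wienerNorm φ ≤ a)
    (hsmall : T * (((2 * Real.pi)⁻¹) ^ 2 * (2 * a) ^ 3) < a) :
    ∀ t ∈ Icc 0 T, wienerNorm (u t) ≤ 2 * a := by
  refine le_two_mul_of_bootstrap (h.continuousOn_wienerNorm hT) fun t ht hW => ?_
  have hφ : IsWiener φ := by
    have h0 := h.isWiener hT ⟨le_rfl, hT.le⟩
    rwa [funext h.initial] at h0
  have h1 := wienerNorm_le_of_sum_sub_le (fun k => norm_exp_I_mul (symbol α k) t) hφ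
    fun F => h.sum_norm_sub_linear_le hT hα₀ hα ht (by positivity) hW F
  linarith

theorem norm_sub_linearWave_le (hT : 0 < T) (hα₀ : 0 < α) (hα : α < 1) {S : Finset ℤ} {ε : ℝ}
    (h : IsSmoothSolution α T (fun x => ε * linearWave α S 0 x) u) {W : ℝ} (hW₀ : 0 ≤ W)
    (hW : ∀ t ∈ Icc 0 T, wienerNorm (u t) ≤ W) {t : ℝ} (ht : t ∈ Icc 0 T) (x : ℝ) :
    ‖u t x - ε * linearWave α S t x‖ ≤
      (2 * Real.pi)⁻¹ * (T * (((2 * Real.pi)⁻¹) ^ 2 * W ^ 3)) := by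
  have hw : IsWiener fun x => u t x - ε * linearWave α S t x :=
    (h.isWiener hT ht).sub ((isWiener_linearWave α S t).const_mul ε)
  refine (hw.norm_le x).trans (mul_le_mul_of_nonneg_left ?_ (by positivity))
  refine Real.tsum_le_of_sum_le (fun _ => norm_nonneg _) fun F => ?_
  refine le_trans (le_of_eq ?_) (h.sum_norm_sub_linear_le hT hα₀ hα ht hW₀
    (fun τ hτ => hW τ ⟨hτ.1, hτ.2.le.trans ht.2⟩) F)
  refine Finset.sum_congr rfl fun k _ => ?_
  rw [fourierCoef_sub (h.isWiener hT ht).continuous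
    ((isWiener_linearWave α S t).const_mul ε).continuous, fourierCoef_const_mul,
    fourierCoef_const_mul, fourierCoef_linearWave, fourierCoef_linearWave]
  congr 2
  split_ifs
  · simp only [Complex.ofReal_zero, mul_zero, Complex.exp_zero]
    ring
  · ring

/-- Expansion to fifth order in the size of the data. -/
theorem exists_expansion (hT : 0 < T) (hα₀ : 0 < α) (hα : α < 1) (S : Finset ℤ) :
    ∃ C ε₀ : ℝ, 0 < ε₀ ∧ ∀ ε ∈ Ioo 0 ε₀, ∀ u : ℝ → ℝ → ℂ,
      IsSmoothSolution α T (fun x => ε * linearWave α S 0 x) u → ∀ k : ℤ,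
        ‖fourierCoef (u T) k - Complex.exp (Complex.I * symbol α k * T) *
          ((ε : ℂ) * fourierCoef (linearWave α S 0) k + (ε : ℂ) ^ 3 * cubicTerm α T S k)‖ ≤
            C * ε ^ 5 := by
  set q : ℝ := ((2 * Real.pi)⁻¹) ^ 2 with hq
  have hq0 : 0 < q := by positivity
  -- The wave over S has Wiener norm `S.card`; adding 1 keeps A positive when S is empty.
  set A : ℝ := S.card + 1 with hA
  have hA0 : 0 < A := by positivity
  -- This factor from Fourier inversion absorbs the 2 of the bootstrap, so that εA bounds the sup
  -- norms of both the solution and the linear wave.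
  have hinv : (2 * Real.pi)⁻¹ ≤ 1 / 2 := by
    rw [inv_le_comm₀ (by positivity) (by norm_num)]
    linarith [Real.pi_gt_three]
  refine ⟨T * (3 * A ^ 2 * (T * (q * (2 * A) ^ 3))), √((16 * T * q * A ^ 2)⁻¹),
    Real.sqrt_pos.2 (by positivity), fun ε hε u h k => ?_⟩
  have hε0 : 0 < ε := hε.1
  have hnε : ‖(ε : ℂ)‖ = ε := by rw [Complex.norm_real, Real.norm_of_nonneg hε0.le]
  have hε2 : ε ^ 2 < (16 * T * q * A ^ 2)⁻¹ := by
    have := (Real.lt_sqrt hε0.le).1 hε.2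
    exact this
  -- This amounts to 8 T q A² ε² < 1; the 16 in ε₀ leaves a factor 2 to spare.
  have hsmall : T * (q * (2 * (ε * A)) ^ 3) < ε * A := by
    rw [lt_inv_comm₀ (by positivity) (by positivity), ← one_div, lt_div_iff₀ (by positivity)] at hε2
    have : 0 < ε * A := by positivity
    nlinarith
  have hwl (t : ℝ) : wienerNorm (fun x => ε * linearWave α S t x) ≤ ε * A := by
    rw [wienerNorm_const_mul, wienerNorm_linearWave, hnε]
    gcongr
    linarith
  have hW := h.wienerNorm_le hT hα₀ hα (by positivity) (hwl 0) hsmall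
  -- The solution differs from εw, w the linear wave, by O(ε³), and the cubic map has Lipschitz
  -- constant O(ε²) at this size: this is the origin of ε⁵.
  have hdiff (τ : ℝ) (hτ : τ ∈ Icc 0 T) :
      ‖nonlinearCoef (u τ) k - (ε : ℂ) ^ 3 * nonlinearCoef (linearWave α S τ) k‖ ≤
        3 * (ε * A) ^ 2 * (T * (q * (2 * (ε * A)) ^ 3)) := by
    have hlw := (isWiener_linearWave α S τ).const_mul ε
    have hu := h.isWiener hT hτ
    rw [← nonlinearCoef_smul]
    refine (norm_nonlinearCoef_sub_le hu.continuous hlw.continuous (M := ε * A)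
      (fun x => (hu.norm_le x).trans ?_) (fun x => (hlw.norm_le x).trans ?_)
      (h.norm_sub_linearWave_le hT hα₀ hα (by positivity) hW hτ) k).trans_eq ?_
    · calc _ ≤ 1 / 2 * (2 * (ε * A)) :=
            mul_le_mul hinv (hW τ hτ) (wienerNorm_nonneg _) (by norm_num)
        _ = _ := by ring
    · calc _ ≤ 1 / 2 * (ε * A) := mul_le_mul hinv (hwl τ) (wienerNorm_nonneg _) (by norm_num)
        _ ≤ _ := by linarith [mul_pos hε0 hA0]
    · rw [← hq]
      have := Real.pi_ne_zero
      field_simp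
  have hTm : T ∈ Icc 0 T := ⟨hT.le, le_rfl⟩
  have hexp : Continuous fun τ : ℝ => Complex.exp (-(Complex.I * symbol α k * τ)) := by fun_prop
  have hi1 : IntervalIntegrable (fun τ : ℝ => Complex.I *
      (Complex.exp (-(Complex.I * symbol α k * τ)) * nonlinearCoef (u τ) k))
      MeasureTheory.volume 0 T := by
    refine ContinuousOn.intervalIntegrable ?_
    rw [uIcc_of_le hT.le]
    exact continuousOn_const.mul (hexp.continuousOn.mul (h.continuousOn_nonlinearCoef hT k))
  have hi2 : IntervalIntegrable (fun τ : ℝ => (ε : ℂ) ^ 3 * (Complex.I *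
      (Complex.exp (-(Complex.I * symbol α k * τ)) * nonlinearCoef (linearWave α S τ) k)))
      MeasureTheory.volume 0 T :=
    (continuous_const.mul (continuous_const.mul
      (hexp.mul (continuous_nonlinearCoef_linearWave α S k)))).intervalIntegrable _ _
  have hmain : fourierCoef (u T) k - Complex.exp (Complex.I * symbol α k * T) *
      ((ε : ℂ) * fourierCoef (linearWave α S 0) k + (ε : ℂ) ^ 3 * cubicTerm α T S k) =
      Complex.exp (Complex.I * symbol α k * T) * ∫ τ in (0 : ℝ)..T, Complex.I *
        (Complex.exp (-(Complex.I * symbol α k * τ)) * (nonlinearCoef (u τ) k -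
          (ε : ℂ) ^ 3 * nonlinearCoef (linearWave α S τ) k)) := by
    have h1 := h.fourierCoef_eq hT hα₀ hα hTm k
    rw [fourierCoef_const_mul] at h1
    have h2 : (∫ τ in (0 : ℝ)..T, Complex.I * (Complex.exp (-(Complex.I * symbol α k * τ)) *
        (nonlinearCoef (u τ) k - (ε : ℂ) ^ 3 * nonlinearCoef (linearWave α S τ) k))) =
        (∫ τ in (0 : ℝ)..T, Complex.I * (Complex.exp (-(Complex.I * symbol α k * τ)) *
          nonlinearCoef (u τ) k)) - (ε : ℂ) ^ 3 * cubicTerm α T S k := by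
      rw [cubicTerm, ← intervalIntegral.integral_const_mul, ← intervalIntegral.integral_sub hi1 hi2]
      congr 1
      funext τ
      ring
    rw [h2]
    linear_combination h1
  rw [hmain, norm_mul, norm_exp_I_mul, one_mul]
  have hbd := intervalIntegral.norm_integral_le_of_norm_le_const (a := 0) (b := T)
    (f := fun τ : ℝ => Complex.I * (Complex.exp (-(Complex.I * symbol α k * τ)) *
      (nonlinearCoef (u τ) k - (ε : ℂ) ^ 3 * nonlinearCoef (linearWave α S τ) k)))
    (C := 3 * (ε * A) ^ 2 * (T * (q * (2 * (ε * A)) ^ 3))) (by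
      intro τ hτ
      rw [uIoc_of_le hT.le] at hτ
      rw [norm_mul, norm_mul, Complex.norm_I, norm_exp_neg_I_mul, one_mul, one_mul]
      exact hdiff τ ⟨hτ.1.le, hτ.2⟩)
  rw [sub_zero, abs_of_pos hT] at hbd
  refine hbd.trans_eq ?_
  ring

end IsSmoothSolution

/-! ### Forward differences of differentiable maps -/

section ForwardDifferences

universe v

variable {E F : Type v} [NormedAddCommGroup E] [NormedSpace ℝ E] [NormedAddCommGroup F]
  [NormedSpace ℝ F]

theorem hasFDerivAt_fwdDiff_iter {f : E → F} {f' : E → E →L[ℝ] F} {R : ℝ}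
    (hf : ∀ y, ‖y‖ < R → HasFDerivAt f (f' y) y) (h : E) (n : ℕ) :
    ∀ x, ‖x‖ + n * ‖h‖ < R → HasFDerivAt ((fwdDiff h)^[n] f) ((fwdDiff h)^[n] f' x) x := by
  induction n with
  | zero => exact fun x hx => hf x (by simpa using hx)
  | succ n ih =>
    intro x hx
    push_cast at hx
    have hh := norm_nonneg h
    have h1 := ih x (by linarith)
    have h2 := ih (x + h) (by linarith [norm_add_le x h])
    rw [Function.iterate_succ_apply', Function.iterate_succ_apply']
    exact ((hasFDerivAt_comp_add_right h).2 h2).sub h1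

/-- The `n`-th forward difference of a `C^n` function is `O(‖h‖^n)`. -/
theorem exists_norm_fwdDiff_iter_le (n : ℕ) : ∀ {F : Type v} [NormedAddCommGroup F]
    [NormedSpace ℝ F] {f : E → F}, ContDiffAt ℝ n f 0 → ∃ C ρ : ℝ, 0 < ρ ∧ ∀ x h : E,
      ‖x‖ < ρ → ‖h‖ < ρ → ‖(fwdDiff h)^[n] f x‖ ≤ C * ‖h‖ ^ n := by
  induction n with
  | zero =>
    intro F _ _ f hf
    have hc := hf.continuousAt.norm.eventually (gt_mem_nhds (lt_add_one ‖f 0‖))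
    obtain ⟨ρ, hρ, hb⟩ := Metric.eventually_nhds_iff.1 hc
    refine ⟨‖f 0‖ + 1, ρ, hρ, fun x h hx _ => ?_⟩
    simpa using (hb (by simpa using hx)).le
  | succ n ih =>
    intro F _ _ f hf
    -- The derivative takes values in E →L[ℝ] F, hence the induction over all targets F; a common
    -- universe for E and F keeps this space in the same universe.
    obtain ⟨C, ρ₁, hρ₁, hC⟩ := ih (f := fderiv ℝ f) (hf.fderiv_right (m := n) (by norm_cast))
    have hd : ∀ᶠ y in nhds (0 : E), HasFDerivAt f (fderiv ℝ f y) y := by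
      have h1 : ContDiffAt ℝ 1 f 0 := hf.of_le (by norm_cast; omega)
      filter_upwards [h1.eventually (by simp)] with y hy
      exact (hy.differentiableAt (by simp)).hasFDerivAt
    obtain ⟨R, hR, hfd⟩ := Metric.eventually_nhds_iff.1 hd
    have hfd' : ∀ y, ‖y‖ < R → HasFDerivAt f (fderiv ℝ f y) y := fun y hy =>
      hfd (by simpa using hy)
    have hn : (0 : ℝ) < n + 2 := by positivity
    -- The mean value inequality is used on the segment from x to x + h. Its points have norm at
    -- most ‖x‖ + ‖h‖ < ρ₁, and the n further shifts by h stay within ‖x‖ + (n + 1)‖h‖ < R.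
    refine ⟨C, min (ρ₁ / 2) (R / (n + 2)), lt_min (by positivity) (by positivity),
      fun x h hx hh => ?_⟩
    have hx1 := hx.trans_le (min_le_left _ _)
    have hx2 := hx.trans_le (min_le_right _ _)
    have hh1 := hh.trans_le (min_le_left _ _)
    have hh2 := hh.trans_le (min_le_right _ _)
    rw [lt_div_iff₀ hn] at hx2 hh2
    have hseg : ∀ y ∈ segment ℝ x (x + h), ‖y‖ ≤ ‖x‖ + ‖h‖ := by
      rintro y hy
      rw [segment_eq_image'] at hy
      obtain ⟨θ, hθ, rfl⟩ := hy
      simp only [add_sub_cancel_left]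
      refine (norm_add_le _ _).trans ?_
      rw [norm_smul, Real.norm_of_nonneg hθ.1]
      have := mul_le_mul_of_nonneg_right hθ.2 (norm_nonneg h)
      linarith
    have hmv := (convex_segment x (x + h)).norm_image_sub_le_of_norm_hasFDerivWithin_le
      (𝕜 := ℝ) (f := (fwdDiff h)^[n] f) (f' := (fwdDiff h)^[n] (fderiv ℝ f)) (C := C * ‖h‖ ^ n)
      (fun y hy => (hasFDerivAt_fwdDiff_iter hfd' h n y (by
        have := hseg y hy
        rcases le_total ‖x‖ ‖h‖ with hle | hle <;> nlinarith [norm_nonneg x, norm_nonneg h,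
          (Nat.cast_nonneg n : (0 : ℝ) ≤ n)])).hasFDerivWithinAt)
      (fun y hy => hC y h (by linarith [hseg y hy]) (by linarith [norm_nonneg h]))
      (left_mem_segment ℝ x (x + h)) (right_mem_segment ℝ x (x + h))
    rw [Function.iterate_succ_apply', fwdDiff]
    refine hmv.trans_eq ?_
    rw [add_sub_cancel_left, pow_succ, mul_assoc]

end ForwardDifferences

theorem fwdDiff_iter_three {E F : Type*} [AddCommGroup E] [AddCommGroup F] (f : E → F) (h x : E) :
    (fwdDiff h)^[3] f x = f (x + h + h + h) - 3 • f (x + h + h) + 3 • f (x + h) - f x := by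
  simp only [Function.iterate_succ, Function.iterate_zero, Function.comp, id, fwdDiff]
  abel


/-! ### Finite sums of modes in the Sobolev space -/

namespace Hs

variable {s : ℝ}

theorem sum_weight_sq_mul_le (a : Hs s) (F : Finset ℤ) :
    ∑ k ∈ F, weight s k ^ 2 * ‖a.coeff k‖ ^ 2 ≤ ‖a‖ ^ 2 := by
  have h := lp.sum_rpow_le_norm_rpow (p := 2) (by norm_num) (toEll2 s a) F
  simp only [ENNReal.toReal_ofNat, Real.rpow_ofNat] at h
  refine le_trans (le_of_eq (Finset.sum_congr rfl fun k _ => ?_)) h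
  have hk : toEll2 s a k = (weight s k : ℂ) * a.coeff k := rfl
  rw [hk, norm_mul, Complex.norm_real, Real.norm_of_nonneg (weight_pos s k).le, mul_pow]

theorem coeff_add (a b : Hs s) (k : ℤ) : (a + b).coeff k = a.coeff k + b.coeff k := rfl

theorem coeff_sub (a b : Hs s) (k : ℤ) : (a - b).coeff k = a.coeff k - b.coeff k := rfl

theorem coeff_smul (ε : ℝ) (a : Hs s) (k : ℤ) : (ε • a).coeff k = ε * a.coeff k := rfl

theorem coeff_nsmul (n : ℕ) (a : Hs s) (k : ℤ) : (n • a).coeff k = n * a.coeff k := by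
  induction n with
  | zero => rw [zero_smul]; simp only [Nat.cast_zero, zero_mul]; rfl
  | succ n ih => rw [succ_nsmul, coeff_add, ih]; push_cast; ring

/-- The sum of the modes `e^{ikx} / 2π`, `k ∈ S`, as an element of `H^s(𝕋)`. -/
def modeSum (s : ℝ) (S : Finset ℤ) : Hs s :=
  ⟨fun k => if k ∈ S then 1 else 0, by
    refine memℓp_gen (summable_of_ne_finset_zero (s := S) fun k hk => ?_)
    simp [hk]⟩

theorem coeff_modeSum (S : Finset ℤ) (k : ℤ) :
    (modeSum s S).coeff k = if k ∈ S then 1 else 0 := rfl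

theorem norm_modeSum_sq (S : Finset ℤ) : ‖modeSum s S‖ ^ 2 = ∑ k ∈ S, weight s k ^ 2 := by
  have h := lp.norm_rpow_eq_tsum (p := 2) (by norm_num) (toEll2 s (modeSum s S))
  simp only [ENNReal.toReal_ofNat, Real.rpow_ofNat] at h
  have hk (k : ℤ) : toEll2 s (modeSum s S) k = (weight s k : ℂ) * if k ∈ S then 1 else 0 := rfl
  have hn : ‖modeSum s S‖ = ‖toEll2 s (modeSum s S)‖ := rfl
  rw [hn, h, tsum_eq_sum (s := S)]
  · refine Finset.sum_congr rfl fun k hkS => ?_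
    rw [hk, if_pos hkS, mul_one, Complex.norm_real, Real.norm_of_nonneg (weight_pos s k).le]
  · intro k hkS
    rw [hk, if_neg hkS, mul_zero, norm_zero, zero_pow two_ne_zero]

end Hs

/-! ### From C³ regularity to a trilinear bound -/

open Filter Topology

/-- The weights 1, -3, 3, -1 at 4, 3, 2, 1 annihilate the linear term, and 64 - 81 + 24 - 1 = 6 on
cubes. The nodes start at ε because the expansion is available only for positive ε. -/
theorem tendsto_third_difference {f : ℝ → ℂ} {e L A : ℂ} {C ε₀ : ℝ} (hε₀ : 0 < ε₀)
    (hf : ∀ ε ∈ Ioo 0 ε₀, ‖f ε - e * (ε * L + (ε : ℂ) ^ 3 * A)‖ ≤ C * ε ^ 5) :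
    Tendsto (fun ε : ℝ => ((ε : ℂ) ^ 3)⁻¹ *
      (f (4 * ε) - 3 * f (3 * ε) + 3 * f (2 * ε) - f ε)) (𝓝[>] 0) (𝓝 (6 * (e * A))) := by
  rw [tendsto_iff_norm_sub_tendsto_zero]
  have hlim : Tendsto (fun ε : ℝ => C * 1850 * ε ^ 2) (𝓝[>] 0) (𝓝 0) := by
    have hc : Continuous fun ε : ℝ => C * 1850 * ε ^ 2 := by fun_prop
    have := hc.tendsto 0
    simp only [ne_eq, OfNat.ofNat_ne_zero, not_false_eq_true, zero_pow, mul_zero] at this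
    exact this.mono_left nhdsWithin_le_nhds
  refine squeeze_zero' (Eventually.of_forall fun _ => norm_nonneg _) ?_ hlim
  filter_upwards [Ioo_mem_nhdsGT (show (0 : ℝ) < ε₀ / 4 by positivity)] with ε hε
  have hε1 : 0 < ε := hε.1
  have hε2 : ε < ε₀ / 4 := hε.2
  have hεc : (ε : ℂ) ≠ 0 := Complex.ofReal_ne_zero.2 hε1.ne'
  have h1 := hf ε ⟨hε1, by linarith⟩
  have h2 := hf (2 * ε) ⟨by linarith, by linarith⟩
  have h3 := hf (3 * ε) ⟨by linarith, by linarith⟩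
  have h4 := hf (4 * ε) ⟨by linarith, by linarith⟩
  set r : ℝ → ℂ := fun ε => f ε - e * (ε * L + (ε : ℂ) ^ 3 * A) with hr
  have heq : ((ε : ℂ) ^ 3)⁻¹ * (f (4 * ε) - 3 * f (3 * ε) + 3 * f (2 * ε) - f ε) - 6 * (e * A) =
      ((ε : ℂ) ^ 3)⁻¹ * (r (4 * ε) - 3 * r (3 * ε) + 3 * r (2 * ε) - r ε) := by
    simp only [hr]
    push_cast
    field_simp
    ring
  -- 1850 = 4⁵ + 3·3⁵ + 3·2⁵ + 1.
  have hb : ‖r (4 * ε) - 3 * r (3 * ε) + 3 * r (2 * ε) - r ε‖ ≤ C * 1850 * ε ^ 5 := by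
    calc _ ≤ ‖r (4 * ε)‖ + 3 * ‖r (3 * ε)‖ + 3 * ‖r (2 * ε)‖ + ‖r ε‖ := by
          refine (norm_sub_le _ _).trans (add_le_add_left ?_ _)
          refine (norm_add_le _ _).trans (add_le_add ?_ (by simp))
          refine (norm_sub_le _ _).trans (add_le_add_right (by simp) _)
      _ ≤ C * (4 * ε) ^ 5 + 3 * (C * (3 * ε) ^ 5) + 3 * (C * (2 * ε) ^ 5) + C * ε ^ 5 := by gcongr
      _ = _ := by ring
  rw [heq, norm_mul, norm_inv, norm_pow, Complex.norm_real, Real.norm_of_nonneg hε1.le,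
    inv_mul_le_iff₀ (by positivity)]
  refine hb.trans_eq ?_
  ring

/-- If the extended flow map is `C³` at the origin, then the cubic Picard iterate is bounded on
`H^s`. -/
theorem exists_cubicTerm_bound {α s r T : ℝ} (hα₀ : 0 < α) (hα : α < 1) (hr : 0 < r) (hT : 0 < T)
    {Φ : Hs s → C(Icc (0 : ℝ) T, Hs s)} (hext : ExtendsSmoothFlow α s r T Φ)
    (hΦ : ContDiffAt ℝ 3 Φ 0) :
    ∃ C : ℝ, ∀ S F : Finset ℤ, ∑ k ∈ F, weight s k ^ 2 * ‖cubicTerm α T S k‖ ^ 2 ≤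
      C * (∑ k ∈ S, weight s k ^ 2) ^ 3 := by
  -- C and ρ are fixed before S is chosen, which makes the final constant independent of S; 36 is
  -- the square of the 6 in the third difference.
  obtain ⟨C, ρ, hρ, hC⟩ := exists_norm_fwdDiff_iter_le 3 hΦ
  refine ⟨C ^ 2 / 36, fun S F => ?_⟩
  set T' : Icc (0 : ℝ) T := ⟨T, hT.le, le_rfl⟩ with hT'
  set a : Hs s := Hs.modeSum s S with ha
  obtain ⟨K, ε₀, hε₀, hK⟩ := IsSmoothSolution.exists_expansion (α := α) hT hα₀ hα S
  set ε₁ : ℝ := min ε₀ (r / (‖a‖ + 1)) with hε₁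
  have hε₁0 : 0 < ε₁ := lt_min hε₀ (by positivity)
  have hexp (k : ℤ) : ∀ ε ∈ Ioo 0 ε₁, ‖(Φ (ε • a) T').coeff k -
      Complex.exp (Complex.I * symbol α k * T) * (ε * fourierCoef (linearWave α S 0) k +
        (ε : ℂ) ^ 3 * cubicTerm α T S k)‖ ≤ K * ε ^ 5 := by
    intro ε hε
    have hball : ε • a ∈ Metric.closedBall (0 : Hs s) r := by
      rw [mem_closedBall_zero_iff, norm_smul, Real.norm_of_nonneg hε.1.le]
      have h1 := (hε.2.trans_le (min_le_right _ _)).le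
      rw [le_div_iff₀ (by positivity)] at h1
      have := hε.1
      linarith
    obtain ⟨u, hu, hcoef⟩ := hext (fun x => ε * linearWave α S 0 x)
      ⟨contDiff_const.mul (contDiff_linearWave α S 0), fun x => by
        simp only [periodic_linearWave α S 0 x]⟩ (ε • a) hball (by
        intro k
        rw [fourierCoef_const_mul, fourierCoef_linearWave, Hs.coeff_smul, ha, Hs.coeff_modeSum]
        simp)
    rw [hcoef T' k]
    exact hK ε ⟨hε.1, hε.2.trans_le (min_le_left _ _)⟩ u hu k
  have hlim (k : ℤ) := tendsto_third_difference hε₁0 (hexp k)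
  -- The limit is known only coefficient by coefficient, so the H^s norm is tested on finitely many
  -- frequencies.
  have hlimsum := tendsto_finsetSum F fun k _ => ((hlim k).norm.pow 2).const_mul (weight s k ^ 2)
  have hnorm (k : ℤ) : ‖6 * (Complex.exp (Complex.I * symbol α k * T) * cubicTerm α T S k)‖ =
      6 * ‖cubicTerm α T S k‖ := by
    rw [norm_mul, norm_mul, norm_exp_I_mul, one_mul]
    simp
  have hle : ∑ k ∈ F, weight s k ^ 2 *
      ‖6 * (Complex.exp (Complex.I * symbol α k * T) * cubicTerm α T S k)‖ ^ 2 ≤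
        C ^ 2 * (∑ k ∈ S, weight s k ^ 2) ^ 3 := by
    refine le_of_tendsto hlimsum ?_
    filter_upwards [Ioo_mem_nhdsGT (show (0 : ℝ) < ρ / (‖a‖ + 1) by positivity)] with ε hε
    have hε0 : 0 < ε := hε.1
    have hsmall : ‖ε • a‖ < ρ := by
      rw [norm_smul, Real.norm_of_nonneg hε0.le]
      have h1 := hε.2
      rw [lt_div_iff₀ (by positivity)] at h1
      linarith
    -- The base point is εa, not 0, so that the third difference samples Φ at εa, 2εa, 3εa, 4εa.
    have hD := hC (ε • a) (ε • a) hsmall hsmall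
    set D : C(Icc (0 : ℝ) T, Hs s) := (fwdDiff (ε • a))^[3] Φ (ε • a) with hDdef
    have hDT : ‖D T'‖ ≤ C * ‖ε • a‖ ^ 3 := (D.norm_coe_le_norm T').trans hD
    have hDc (k : ℤ) : (D T').coeff k = (Φ ((4 * ε) • a) T').coeff k -
        3 * (Φ ((3 * ε) • a) T').coeff k + 3 * (Φ ((2 * ε) • a) T').coeff k -
          (Φ (ε • a) T').coeff k := by
      have e2 : ε • a + ε • a = (2 * ε) • a := by rw [← add_smul]; congr 1; ring
      have e3 : (2 * ε) • a + ε • a = (3 * ε) • a := by rw [← add_smul]; congr 1; ring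
      have e4 : (3 * ε) • a + ε • a = (4 * ε) • a := by rw [← add_smul]; congr 1; ring
      rw [hDdef, fwdDiff_iter_three, e2, e3, e4]
      simp only [ContinuousMap.sub_apply, ContinuousMap.add_apply, ContinuousMap.nsmul_apply,
        Hs.coeff_sub, Hs.coeff_add, Hs.coeff_nsmul, Nat.cast_ofNat]
    have hsum := Hs.sum_weight_sq_mul_le (D T') F
    have hsq : ‖D T'‖ ^ 2 ≤ ε ^ 6 * (C ^ 2 * (∑ k ∈ S, weight s k ^ 2) ^ 3) := by
      have h1 : ‖D T'‖ ^ 2 ≤ (C * ‖ε • a‖ ^ 3) ^ 2 := by gcongr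
      refine h1.trans_eq ?_
      rw [norm_smul, Real.norm_of_nonneg hε0.le, ← Hs.norm_modeSum_sq, ← ha]
      ring
    have hε6 : (0 : ℝ) < ε ^ 6 := by positivity
    rw [← mul_le_mul_iff_right₀ hε6, Finset.mul_sum]
    refine le_trans (le_of_eq (Finset.sum_congr rfl fun k _ => ?_)) (hsum.trans hsq)
    rw [hDc k, norm_mul, norm_inv, norm_pow, Complex.norm_real, Real.norm_of_nonneg hε0.le]
    field_simp
  simp only [hnorm] at hle
  have heq : ∑ k ∈ F, weight s k ^ 2 * (6 * ‖cubicTerm α T S k‖) ^ 2 =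
      36 * ∑ k ∈ F, weight s k ^ 2 * ‖cubicTerm α T S k‖ ^ 2 := by
    rw [Finset.mul_sum]
    exact Finset.sum_congr rfl fun k _ => by ring
  rw [heq] at hle
  linarith

/-! ### Nearly resonant interactions -/

/-- Two applications of the mean value inequality: the second derivative 2α(2α-1) z^{2α-2} of z^{2α}
lies between 0 and 2N^{2α-2} on the interval, and both increments are at most M. This controls the
phase of an interaction, with p = k - c. -/
theorem abs_rpow_second_difference_le {α N M x y p : ℝ} (hα : 1 / 2 < α) (hα' : α < 1) (hN : 0 < N)
    (hx : x ∈ Icc N (N + M)) (hy : y ∈ Icc N (N + M)) (hxp : x + p ∈ Icc N (N + M))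
    (hyp : y + p ∈ Icc N (N + M)) :
    |((x + p) ^ (2 * α) - x ^ (2 * α)) - ((y + p) ^ (2 * α) - y ^ (2 * α))| ≤
      2 * N ^ (2 * α - 2) * M ^ 2 := by
  have hM : 0 ≤ M := by linarith [hx.1, hx.2]
  have hK : 0 ≤ 2 * N ^ (2 * α - 2) := by positivity
  have hderiv (z : ℝ) (hz : z ∈ Icc N (N + M)) (q : ℝ) :
      HasDerivAt (fun z : ℝ => z ^ q) (q * z ^ (q - 1)) z :=
    Real.hasDerivAt_rpow_const (Or.inl (hN.trans_le hz.1).ne')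
  have hLip : ∀ a ∈ Icc N (N + M), ∀ b ∈ Icc N (N + M),
      ‖2 * α * b ^ (2 * α - 1) - 2 * α * a ^ (2 * α - 1)‖ ≤ 2 * N ^ (2 * α - 2) * ‖b - a‖ := by
    intro a ha b hb
    refine (convex_Icc N (N + M)).norm_image_sub_le_of_norm_hasDerivWithin_le
      (f := fun z => 2 * α * z ^ (2 * α - 1))
      (f' := fun z => 2 * α * ((2 * α - 1) * z ^ (2 * α - 1 - 1)))
      (fun z hz => ((hderiv z hz _).const_mul _).hasDerivWithinAt) (fun z hz => ?_) ha hb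
    have hz0 := hN.trans_le hz.1
    have h1 : z ^ (2 * α - 1 - 1) ≤ N ^ (2 * α - 2) := by
      rw [show 2 * α - 1 - 1 = 2 * α - 2 by ring]
      exact Real.rpow_le_rpow_of_nonpos hN hz.1 (by linarith)
    have h2 : 0 ≤ z ^ (2 * α - 1 - 1) := by positivity
    have h3 : 0 ≤ 2 * α - 1 := by linarith
    have h4 : 2 * α * (2 * α - 1) ≤ 2 := by nlinarith
    rw [Real.norm_of_nonneg (by positivity), ← mul_assoc]
    gcongr
  have hsub : uIcc y x ⊆ Icc N (N + M) := uIcc_subset_Icc hy hx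
  have hsubp : ∀ z ∈ uIcc y x, z + p ∈ Icc N (N + M) := by
    intro z hz
    rcases le_total y x with hle | hle
    · rw [uIcc_of_le hle] at hz
      exact ⟨by linarith [hz.1, hyp.1], by linarith [hz.2, hxp.2]⟩
    · rw [uIcc_of_ge hle] at hz
      exact ⟨by linarith [hz.1, hxp.1], by linarith [hz.2, hyp.2]⟩
  have hmain := (convex_uIcc y x).norm_image_sub_le_of_norm_hasDerivWithin_le
    (f := fun z => (z + p) ^ (2 * α) - z ^ (2 * α))
    (f' := fun z => 2 * α * (z + p) ^ (2 * α - 1) - 2 * α * z ^ (2 * α - 1))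
    (C := 2 * N ^ (2 * α - 2) * |p|)
    (fun z hz => (((hderiv (z + p) (hsubp z hz) (2 * α)).comp_add_const z p).sub
      (hderiv z (hsub hz) _)).hasDerivWithinAt)
    (fun z hz => by
      have := hLip z (hsub hz) (z + p) (hsubp z hz)
      rwa [add_sub_cancel_left] at this)
    left_mem_uIcc right_mem_uIcc
  have hp : |p| ≤ M := abs_le.2 ⟨by linarith [hx.2, hxp.1], by linarith [hx.1, hxp.2]⟩
  have hxy : ‖x - y‖ ≤ M := by
    rw [Real.norm_eq_abs]
    exact abs_le.2 ⟨by linarith [hx.1, hy.2], by linarith [hx.2, hy.1]⟩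
  refine hmain.trans ?_
  calc _ ≤ 2 * N ^ (2 * α - 2) * M * M := by gcongr
    _ = _ := by ring

/-- Multiply out the product with conjugated frequency b; orthogonality selects a - b + c = k, which
eliminates a. -/
theorem nonlinearCoef_linearWave (α : ℝ) (S : Finset ℤ) (τ : ℝ) (k : ℤ) :
    nonlinearCoef (linearWave α S τ) k = ((2 * Real.pi : ℂ)⁻¹) ^ 2 * ∑ b ∈ S, ∑ c ∈ S,
      if k + b - c ∈ S then Complex.exp
        (Complex.I * ((symbol α (k + b - c) - symbol α b + symbol α c : ℝ) : ℂ) * τ) else 0 := by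
  have hconj (x : ℝ) : starRingEnd ℂ (linearWave α S τ x) = ∑ b ∈ S, (2 * Real.pi : ℂ)⁻¹ *
      Complex.exp (-(Complex.I * symbol α b * τ)) * Complex.exp (-(Complex.I * b * x)) := by
    simp only [linearWave, map_sum, map_mul, ← Complex.exp_conj, Complex.conj_I,
      Complex.conj_ofReal, map_inv₀, map_ofNat, map_intCast, neg_mul]
  have hprod (x : ℝ) : (‖linearWave α S τ x‖ : ℂ) ^ 2 * linearWave α S τ x =
      ∑ b ∈ S, ∑ c ∈ S, ∑ a ∈ S, ((2 * Real.pi : ℂ)⁻¹) ^ 3 * Complex.exp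
        (Complex.I * ((symbol α a - symbol α b + symbol α c : ℝ) : ℂ) * τ) *
          Complex.exp (Complex.I * ((a - b + c : ℤ) : ℂ) * x) := by
    have h1 : (‖linearWave α S τ x‖ : ℂ) ^ 2 * linearWave α S τ x =
        starRingEnd ℂ (linearWave α S τ x) * (linearWave α S τ x * linearWave α S τ x) := by
      rw [← Complex.conj_mul', mul_assoc]
    rw [h1, hconj, linearWave, Finset.sum_mul_sum, Finset.sum_mul_sum]
    refine Finset.sum_congr rfl fun b _ => ?_
    refine Finset.sum_congr rfl fun c _ => ?_
    rw [Finset.mul_sum]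
    refine Finset.sum_congr rfl fun a _ => ?_
    have e1 : Complex.exp (Complex.I * ((symbol α a - symbol α b + symbol α c : ℝ) : ℂ) * τ) =
        Complex.exp (Complex.I * symbol α a * τ) * Complex.exp (-(Complex.I * symbol α b * τ)) *
          Complex.exp (Complex.I * symbol α c * τ) := by
      rw [← Complex.exp_add, ← Complex.exp_add]
      congr 1
      push_cast
      ring
    have e2 : Complex.exp (Complex.I * ((a - b + c : ℤ) : ℂ) * x) =
        Complex.exp (Complex.I * a * x) * Complex.exp (-(Complex.I * b * x)) *
          Complex.exp (Complex.I * c * x) := by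
      rw [← Complex.exp_add, ← Complex.exp_add]
      congr 1
      push_cast
      ring
    rw [e1, e2]
    ring
  rw [nonlinearCoef, fourierCoef_congr hprod, fourierCoef_finsetSum S fun b _ => by fun_prop,
    Finset.mul_sum]
  refine Finset.sum_congr rfl fun b _ => ?_
  rw [fourierCoef_finsetSum S fun c _ => by fun_prop, Finset.mul_sum]
  refine Finset.sum_congr rfl fun c _ => ?_
  rw [fourierCoef_finsetSum S fun a _ => by fun_prop]
  have hiff (a : ℤ) : a - b + c = k ↔ k + b - c = a := by omega
  have hπ : (Real.pi : ℂ) ≠ 0 := Complex.ofReal_ne_zero.2 Real.pi_ne_zero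
  simp only [fourierCoef_const_mul, fourierCoef_char, hiff, mul_ite, mul_zero, Finset.sum_ite_eq]
  split_ifs
  · field_simp
  · rfl

theorem re_exp_I_mul (a t : ℝ) : (Complex.exp (Complex.I * a * t)).re = Real.cos (a * t) := by
  rw [show Complex.I * a * t = ((a * t : ℝ) : ℂ) * Complex.I by push_cast; ring,
    Complex.exp_ofReal_mul_I_re]

/-- Nearly resonant interactions add up. -/
theorem le_norm_cubicTerm {α T : ℝ} (hT : 0 < T) {S B : Finset ℤ} {k : ℤ} (hBS : B ⊆ S)
    (hB : ∀ b ∈ B, ∀ c ∈ B, k + b - c ∈ S)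
    (hphase : ∀ b ∈ S, ∀ c ∈ S, k + b - c ∈ S →
      |symbol α (k + b - c) - symbol α b + symbol α c - symbol α k| * T ≤ 1) :
    T * (((2 * Real.pi)⁻¹) ^ 2 * ((B.card : ℝ) ^ 2 * (1 / 2))) ≤ ‖cubicTerm α T S k‖ := by
  set f : ℝ → ℂ := fun τ => Complex.exp (-(Complex.I * symbol α k * τ)) *
    nonlinearCoef (linearWave α S τ) k with hf
  have hfc : Continuous f :=
    Continuous.mul (by fun_prop) (continuous_nonlinearCoef_linearWave α S k)
  have hfre (τ : ℝ) : (f τ).re = ((2 * Real.pi)⁻¹) ^ 2 * ∑ b ∈ S, ∑ c ∈ S,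
      if k + b - c ∈ S then Real.cos
        ((symbol α (k + b - c) - symbol α b + symbol α c - symbol α k) * τ) else 0 := by
    have h1 : f τ = ((((2 * Real.pi)⁻¹) ^ 2 : ℝ) : ℂ) * ∑ b ∈ S, ∑ c ∈ S,
        if k + b - c ∈ S then Complex.exp (Complex.I *
          ((symbol α (k + b - c) - symbol α b + symbol α c - symbol α k : ℝ) : ℂ) * τ) else 0 := by
      simp only [hf]
      rw [nonlinearCoef_linearWave, mul_left_comm, Finset.mul_sum]
      push_cast
      congr 1
      refine Finset.sum_congr rfl fun b _ => ?_
      rw [Finset.mul_sum]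
      refine Finset.sum_congr rfl fun c _ => ?_
      rw [mul_ite, mul_zero]
      congr 1
      rw [← Complex.exp_add]
      congr 1
      ring
    rw [h1, Complex.re_ofReal_mul, Complex.re_sum]
    congr 1
    refine Finset.sum_congr rfl fun b _ => ?_
    rw [Complex.re_sum]
    refine Finset.sum_congr rfl fun c _ => ?_
    split_ifs
    · exact re_exp_I_mul _ _
    · rfl
  have hlow : ∀ τ ∈ Icc 0 T, ((2 * Real.pi)⁻¹) ^ 2 * ((B.card : ℝ) ^ 2 * (1 / 2)) ≤ (f τ).re := by
    intro τ hτ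
    -- Phases at most 1 give cos θ ≥ 1 - θ²/2 ≥ 1/2. Since every interaction in S contributes
    -- nonnegatively, those outside B × B can be dropped.
    have hcos : ∀ b ∈ S, ∀ c ∈ S, k + b - c ∈ S → 1 / 2 ≤ Real.cos
        ((symbol α (k + b - c) - symbol α b + symbol α c - symbol α k) * τ) := by
      intro b hb c hc hk
      set θ := symbol α (k + b - c) - symbol α b + symbol α c - symbol α k
      have h1 : |θ * τ| ≤ 1 := by
        rw [abs_mul, abs_of_nonneg hτ.1]
        exact (mul_le_mul_of_nonneg_left hτ.2 (abs_nonneg θ)).trans (hphase b hb c hc hk)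
      have h2 := Real.one_sub_sq_div_two_le_cos (x := θ * τ)
      have h3 : (θ * τ) ^ 2 ≤ 1 := (sq_le_one_iff_abs_le_one _).2 h1
      linarith
    have hnn : ∀ b ∈ S, ∀ c ∈ S, 0 ≤ if k + b - c ∈ S then Real.cos
        ((symbol α (k + b - c) - symbol α b + symbol α c - symbol α k) * τ) else 0 := by
      intro b hb c hc
      split_ifs with hk
      · linarith [hcos b hb c hc hk]
      · exact le_rfl
    rw [hfre]
    refine mul_le_mul_of_nonneg_left ?_ (by positivity)
    calc (B.card : ℝ) ^ 2 * (1 / 2) = ∑ b ∈ B, ∑ c ∈ B, (1 / 2 : ℝ) := by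
          simp only [Finset.sum_const, nsmul_eq_mul]
          ring
      _ ≤ ∑ b ∈ B, ∑ c ∈ B, if k + b - c ∈ S then Real.cos
            ((symbol α (k + b - c) - symbol α b + symbol α c - symbol α k) * τ) else 0 := by
          refine Finset.sum_le_sum fun b hb => Finset.sum_le_sum fun c hc => ?_
          rw [if_pos (hB b hb c hc)]
          exact hcos b (hBS hb) c (hBS hc) (hB b hb c hc)
      _ ≤ ∑ b ∈ B, ∑ c ∈ S, if k + b - c ∈ S then Real.cos
            ((symbol α (k + b - c) - symbol α b + symbol α c - symbol α k) * τ) else 0 :=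
          Finset.sum_le_sum fun b hb => Finset.sum_le_sum_of_subset_of_nonneg hBS
            fun c hc _ => hnn b (hBS hb) c hc
      _ ≤ _ := Finset.sum_le_sum_of_subset_of_nonneg hBS
            fun b hb _ => Finset.sum_nonneg fun c hc => hnn b hb c hc
  have hcubic : ‖cubicTerm α T S k‖ = ‖∫ τ in (0 : ℝ)..T, f τ‖ := by
    rw [cubicTerm, intervalIntegral.integral_const_mul, norm_mul, Complex.norm_I, one_mul]
  have hre : (∫ τ in (0 : ℝ)..T, f τ).re = ∫ τ in (0 : ℝ)..T, (f τ).re :=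
    (Complex.reCLM.intervalIntegral_comp_comm (hfc.intervalIntegrable 0 T)).symm
  have hmono := intervalIntegral.integral_mono_on hT.le
    (f := fun _ => ((2 * Real.pi)⁻¹) ^ 2 * ((B.card : ℝ) ^ 2 * (1 / 2)))
    (g := fun τ => (f τ).re) (μ := MeasureTheory.volume) intervalIntegrable_const
    ((Complex.continuous_re.comp hfc).intervalIntegrable _ _) hlow
  rw [intervalIntegral.integral_const, sub_zero, smul_eq_mul] at hmono
  rw [hcubic]
  exact hmono.trans (hre ▸ Complex.re_le_norm _)

/-! ### Failure of the trilinear bound on a block of frequencies -/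

theorem bracket_mem {N : ℝ} {k : ℤ} (hN : 1 ≤ N) (h1 : N ≤ k) (h2 : k ≤ 4 * N) :
    N ≤ bracket k ∧ bracket k ≤ 5 * N := by
  constructor
  · exact Real.le_sqrt_of_sq_le (by nlinarith)
  · exact Real.sqrt_le_iff.2 ⟨by linarith, by nlinarith⟩

theorem weight_sq (s : ℝ) (k : ℤ) : weight s k ^ 2 = bracket k ^ (2 * s) * (2 * Real.pi)⁻¹ := by
  rw [weight, div_pow, Real.sq_sqrt (by positivity), ← Real.rpow_natCast (bracket k ^ s) 2,
    ← Real.rpow_mul (bracket_pos k).le, mul_comm s, div_eq_mul_inv]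
  norm_num

/-- On such a block the weight is comparable to N^{2s}; the absolute value in the exponent of 5
covers both signs of s. -/
theorem weight_sq_mem (s : ℝ) {N : ℝ} {k : ℤ} (hN : 1 ≤ N) (h1 : N ≤ k) (h2 : k ≤ 4 * N) :
    (5 : ℝ) ^ (-|2 * s|) * (2 * Real.pi)⁻¹ * N ^ (2 * s) ≤ weight s k ^ 2 ∧
      weight s k ^ 2 ≤ (5 : ℝ) ^ |2 * s| * (2 * Real.pi)⁻¹ * N ^ (2 * s) := by
  obtain ⟨hb1, hb2⟩ := bracket_mem hN h1 h2
  have hN0 : 0 < N := by linarith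
  set θ := bracket k / N with hθ
  have hθ1 : 1 ≤ θ := (one_le_div hN0).2 hb1
  have hθ5 : θ ≤ 5 := (div_le_iff₀ hN0).2 hb2
  have hθ0 : 0 < θ := by linarith
  have hbr : bracket k = θ * N := by rw [hθ]; field_simp
  have hup : θ ^ (2 * s) ≤ 5 ^ |2 * s| :=
    (Real.rpow_le_rpow_of_exponent_le hθ1 (le_abs_self _)).trans
      (Real.rpow_le_rpow hθ0.le hθ5 (abs_nonneg _))
  have hlo : (5 : ℝ) ^ (-|2 * s|) ≤ θ ^ (2 * s) :=
    (Real.rpow_le_rpow_of_nonpos hθ0 hθ5 (neg_nonpos.2 (abs_nonneg _))).trans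
      (Real.rpow_le_rpow_of_exponent_le hθ1 (neg_abs_le _))
  rw [weight_sq, hbr, Real.mul_rpow hθ0.le hN0.le]
  constructor
  · calc _ = (5 : ℝ) ^ (-|2 * s|) * N ^ (2 * s) * (2 * Real.pi)⁻¹ := by ring
      _ ≤ _ := by gcongr
  · calc _ ≤ (5 : ℝ) ^ |2 * s| * N ^ (2 * s) * (2 * Real.pi)⁻¹ := by gcongr
      _ = _ := by ring

/-- The boundedness of the cubic Picard iterate restricts the number of nearly resonant
frequencies. -/
theorem exists_resonance_bound {α s T : ℝ} (hα : 1 / 2 < α) (hα' : α < 1) (hT : 0 < T) {C : ℝ}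
    (hC : ∀ S F : Finset ℤ, ∑ k ∈ F, weight s k ^ 2 * ‖cubicTerm α T S k‖ ^ 2 ≤
      C * (∑ k ∈ S, weight s k ^ 2) ^ 3) :
    ∃ K : ℝ, ∀ N m : ℕ, 1 ≤ m → m ≤ N →
      2 * (N : ℝ) ^ (2 * α - 2) * (3 * m : ℝ) ^ 2 * T ≤ 1 →
        (m : ℝ) ^ 2 ≤ K * (N : ℝ) ^ (4 * s) := by
  set κ₁ : ℝ := (5 : ℝ) ^ (-|2 * s|) * (2 * Real.pi)⁻¹ with hκ₁
  set κ₂ : ℝ := (5 : ℝ) ^ |2 * s| * (2 * Real.pi)⁻¹ with hκ₂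
  set q : ℝ := T * ((2 * Real.pi)⁻¹) ^ 2 / 2 with hq
  have hκ₁0 : 0 < κ₁ := by positivity
  have hκ₂0 : 0 < κ₂ := by positivity
  have hq0 : 0 < q := by positivity
  refine ⟨|C| * (3 * κ₂) ^ 3 / (κ₁ * q ^ 2), fun N m hm hmN hres => ?_⟩
  have hN1 : (1 : ℝ) ≤ N := by exact_mod_cast hm.trans hmN
  have hm0 : (0 : ℝ) < m := by exact_mod_cast hm
  have hmN' : (m : ℝ) ≤ N := by exact_mod_cast hmN
  -- The output frequencies F are the middle third of S: for b, c in B the difference b - c is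
  -- smaller than m in absolute value, so k + b - c stays in S. As m ≤ N, all of S lies in [N, 4N].
  set S : Finset ℤ := Finset.Ico (N : ℤ) (N + 3 * m) with hS
  set B : Finset ℤ := Finset.Ico (N : ℤ) (N + m) with hB
  set F : Finset ℤ := Finset.Ico (N + m : ℤ) (N + 2 * m) with hF
  have hSc : (S.card : ℝ) = 3 * m := by
    rw [hS, Int.card_Ico]
    have : ((N : ℤ) + 3 * m - N).toNat = 3 * m := by omega
    rw [this]
    push_cast
    ring
  have hBc : (B.card : ℝ) = m := by
    rw [hB, Int.card_Ico]
    have : ((N : ℤ) + m - N).toNat = m := by omega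
    rw [this]
  have hFc : (F.card : ℝ) = m := by
    rw [hF, Int.card_Ico]
    have : ((N : ℤ) + 2 * m - (N + m)).toNat = m := by omega
    rw [this]
  have hFS : F ⊆ S := Finset.Ico_subset_Ico (by omega) (by omega)
  have hSreal : ∀ k ∈ S, (k : ℝ) ∈ Icc (N : ℝ) (N + 3 * m) := by
    intro k hk
    rw [hS, Finset.mem_Ico] at hk
    exact ⟨by exact_mod_cast hk.1, by exact_mod_cast hk.2.le⟩
  have hSw : ∀ k ∈ S, κ₁ * (N : ℝ) ^ (2 * s) ≤ weight s k ^ 2 ∧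
      weight s k ^ 2 ≤ κ₂ * (N : ℝ) ^ (2 * s) := fun k hk =>
    weight_sq_mem s hN1 (hSreal k hk).1 ((hSreal k hk).2.trans (by linarith))
  have hsymb : ∀ k ∈ S, symbol α k = (k : ℝ) ^ (2 * α) := fun k hk => by
    rw [symbol, abs_of_nonneg (by linarith [(hSreal k hk).1])]
  have hcub : ∀ k ∈ F, q * (m : ℝ) ^ 2 ≤ ‖cubicTerm α T S k‖ := by
    intro k hk
    have hkS := hFS hk
    refine le_trans (le_of_eq ?_) (le_norm_cubicTerm (B := B) hT
      (Finset.Ico_subset_Ico le_rfl (by omega)) ?_ ?_)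
    · rw [hBc, hq]
      ring
    · intro b hb c hc
      rw [hB, Finset.mem_Ico] at hb hc
      rw [hF, Finset.mem_Ico] at hk
      rw [hS, Finset.mem_Ico]
      omega
    · intro b hb c hc ha
      rw [hsymb _ ha, hsymb b hb, hsymb c hc, hsymb k hkS]
      have e1 : ((k + b - c : ℤ) : ℝ) = b + (k - c) := by push_cast; ring
      have e2 : (k : ℝ) = c + (k - c) := by ring
      have ha' := hSreal _ ha
      rw [e1] at ha'
      have hk' := hSreal k hkS
      rw [e2] at hk'
      have h := abs_rpow_second_difference_le hα hα' (by linarith) (hSreal b hb) (hSreal c hc)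
        ha' hk'
      rw [← e2, ← e1] at h
      have h' : ((k + b - c : ℤ) : ℝ) ^ (2 * α) - (b : ℝ) ^ (2 * α) + (c : ℝ) ^ (2 * α) -
          (k : ℝ) ^ (2 * α) = ((k + b - c : ℤ) : ℝ) ^ (2 * α) - (b : ℝ) ^ (2 * α) -
            ((k : ℝ) ^ (2 * α) - (c : ℝ) ^ (2 * α)) := by ring
      rw [h']
      exact (mul_le_mul_of_nonneg_right h hT.le).trans hres
  have hNs : 0 < (N : ℝ) ^ (2 * s) := by positivity
  have hlow : (m : ℝ) * (κ₁ * (N : ℝ) ^ (2 * s) * (q * (m : ℝ) ^ 2) ^ 2) ≤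
      ∑ k ∈ F, weight s k ^ 2 * ‖cubicTerm α T S k‖ ^ 2 := by
    have h := Finset.card_nsmul_le_sum F (fun k => weight s k ^ 2 * ‖cubicTerm α T S k‖ ^ 2)
      (κ₁ * (N : ℝ) ^ (2 * s) * (q * (m : ℝ) ^ 2) ^ 2) (fun k hk => by
        have h1 := (hSw k (hFS hk)).1
        have h2 := hcub k hk
        gcongr)
    rwa [nsmul_eq_mul, hFc] at h
  have hup : ∑ k ∈ S, weight s k ^ 2 ≤ 3 * m * (κ₂ * (N : ℝ) ^ (2 * s)) := by
    have h := Finset.sum_le_card_nsmul S (fun k => weight s k ^ 2) _ fun k hk => (hSw k hk).2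
    rwa [nsmul_eq_mul, hSc] at h
  have hsum0 : 0 ≤ ∑ k ∈ S, weight s k ^ 2 := Finset.sum_nonneg fun k _ => sq_nonneg _
  have hfin : (m : ℝ) * (κ₁ * (N : ℝ) ^ (2 * s) * (q * (m : ℝ) ^ 2) ^ 2) ≤
      |C| * (3 * m * (κ₂ * (N : ℝ) ^ (2 * s))) ^ 3 :=
    hlow.trans ((hC S F).trans (mul_le_mul (le_abs_self C) (by gcongr) (by positivity)
      (abs_nonneg C)))
  have h4s : (N : ℝ) ^ (4 * s) = ((N : ℝ) ^ (2 * s)) ^ 2 := by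
    rw [← Real.rpow_natCast, ← Real.rpow_mul (by linarith)]
    congr 1
    push_cast
    ring
  rw [h4s, div_mul_eq_mul_div, le_div_iff₀ (by positivity)]
  -- The common factor of the two sides m⁵ N^{2s} and m³ N^{6s} of `hfin`, up to constants.
  have hpos : 0 < (m : ℝ) ^ 3 * (N : ℝ) ^ (2 * s) := by positivity
  refine le_of_mul_le_mul_left ?_ hpos
  calc _ = (m : ℝ) * (κ₁ * (N : ℝ) ^ (2 * s) * (q * (m : ℝ) ^ 2) ^ 2) := by ring
    _ ≤ _ := hfin
    _ = _ := by ring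

/-- Take m = ⌊c N^{1-α}⌋, the largest order of size the phase condition allows; then m² is
comparable to N^{2(1-α)}, whose exponent exceeds 4s. -/
theorem not_resonance_bound {α s T : ℝ} (hα : 1 / 2 < α) (hα' : α < 1) (hs : s < (1 - α) / 2)
    (hT : 0 < T) (K : ℝ) :
    ¬ ∀ N m : ℕ, 1 ≤ m → m ≤ N → 2 * (N : ℝ) ^ (2 * α - 2) * (3 * m : ℝ) ^ 2 * T ≤ 1 →
      (m : ℝ) ^ 2 ≤ K * (N : ℝ) ^ (4 * s) := by
  intro h
  -- The phase condition at 3m reads 18 T c² ≤ 1, since 2·3² = 18; c ≤ 1 ensures m ≤ N.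
  set c : ℝ := min 1 (√(18 * T))⁻¹ with hc
  have hc0 : 0 < c := lt_min one_pos (by positivity)
  have hc1 : c ≤ 1 := min_le_left _ _
  have hcT : 18 * T * c ^ 2 ≤ 1 := by
    have h1 : c ^ 2 ≤ ((√(18 * T))⁻¹) ^ 2 := by
      have := min_le_right 1 (√(18 * T))⁻¹
      gcongr
    rw [inv_pow, Real.sq_sqrt (by positivity), ← one_div, le_div_iff₀ (by positivity)] at h1
    linarith
  have ht1 : Tendsto (fun N : ℕ => (N : ℝ) ^ (1 - α)) atTop atTop :=
    (tendsto_rpow_atTop (by linarith)).comp tendsto_natCast_atTop_atTop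
  have ht2 : Tendsto (fun N : ℕ => (N : ℝ) ^ (2 * (1 - α) - 4 * s)) atTop atTop :=
    (tendsto_rpow_atTop (by linarith)).comp tendsto_natCast_atTop_atTop
  obtain ⟨N, hN1, hNa, hNb⟩ := ((eventually_ge_atTop 1).and ((ht1.eventually_ge_atTop (1 / c)).and
    (ht2.eventually_gt_atTop (4 * K / c ^ 2)))).exists
  have hN : (1 : ℝ) ≤ N := by exact_mod_cast hN1
  have hN0 : (0 : ℝ) < N := by linarith
  set R : ℝ := c * (N : ℝ) ^ (1 - α) with hR
  have hR1 : 1 ≤ R := by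
    rw [div_le_iff₀ hc0] at hNa
    linarith
  have hfl : (⌊R⌋₊ : ℝ) ≤ R := Nat.floor_le (by linarith)
  have hfl' : R < ⌊R⌋₊ + 1 := Nat.lt_floor_add_one R
  have hfl1 : 1 ≤ ⌊R⌋₊ := Nat.one_le_floor_iff R |>.2 hR1
  have hfl1' : (1 : ℝ) ≤ ⌊R⌋₊ := by exact_mod_cast hfl1
  have hRN : R ≤ N := by
    calc R ≤ 1 * (N : ℝ) ^ (1 : ℝ) := by
          refine mul_le_mul hc1 (Real.rpow_le_rpow_of_exponent_le hN (by linarith))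
            (by positivity) zero_le_one
      _ = N := by rw [one_mul, Real.rpow_one]
  have hpow : (N : ℝ) ^ (2 * α - 2) * ((N : ℝ) ^ (1 - α)) ^ 2 = 1 := by
    rw [← Real.rpow_natCast, ← Real.rpow_mul hN0.le, ← Real.rpow_add hN0]
    have : 2 * α - 2 + (1 - α) * ((2 : ℕ) : ℝ) = 0 := by push_cast; ring
    rw [this, Real.rpow_zero]
  have hb := h N ⌊R⌋₊ hfl1 (by exact_mod_cast hfl.trans hRN) (by
    calc 2 * (N : ℝ) ^ (2 * α - 2) * (3 * ⌊R⌋₊ : ℝ) ^ 2 * T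
        ≤ 2 * (N : ℝ) ^ (2 * α - 2) * (3 * R) ^ 2 * T := by gcongr
      _ = 18 * T * c ^ 2 * ((N : ℝ) ^ (2 * α - 2) * ((N : ℝ) ^ (1 - α)) ^ 2) := by
          rw [hR]
          ring
      _ ≤ 1 := by rw [hpow, mul_one]; exact hcT)
  -- As R ≥ 1, rounding down loses at most a factor 2; this is the 4 in the threshold 4K/c².
  have hR2 : R ^ 2 ≤ 4 * (⌊R⌋₊ : ℝ) ^ 2 := by nlinarith
  have hsplit : (N : ℝ) ^ (2 * (1 - α) - 4 * s) * (N : ℝ) ^ (4 * s) = ((N : ℝ) ^ (1 - α)) ^ 2 := by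
    rw [← Real.rpow_natCast, ← Real.rpow_mul hN0.le, ← Real.rpow_add hN0]
    congr 1
    push_cast
    ring
  have hN4 : 0 < (N : ℝ) ^ (4 * s) := by positivity
  rw [div_lt_iff₀ (by positivity)] at hNb
  have hlt := mul_lt_mul_of_pos_right hNb hN4
  have : R ^ 2 = (N : ℝ) ^ (2 * (1 - α) - 4 * s) * c ^ 2 * (N : ℝ) ^ (4 * s) := by
    rw [hR, mul_pow, ← hsplit]
    ring
  linarith

end FNLS

end

theorem theorem2 (α s r T : ℝ) (hα : 1 / 2 < α) (hα' : α < 1) (hs : s < (1 - α) / 2)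
    (hr : 0 < r) (hT : 0 < T) (Φ : FNLS.Hs s → C(Set.Icc (0 : ℝ) T, FNLS.Hs s))
    (hcont : ContinuousOn Φ (Metric.closedBall 0 r))
    (hext : FNLS.ExtendsSmoothFlow α s r T Φ) :
    ¬ ContDiffAt ℝ 3 Φ 0 := by
  intro hΦ
  obtain ⟨C, hC⟩ := FNLS.exists_cubicTerm_bound (by linarith) hα' hr hT hext hΦ
  obtain ⟨K, hK⟩ := FNLS.exists_resonance_bound hα hα' hT hC
  exact FNLS.not_resonance_bound hα hα' hs hT K hK
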